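/- **Setting.** Let $S$ be a finite set, $A=\mathbb R^d$ with $d\ge 1$, $\lambda$ Lebesgue measure on $A$, $P$ a probability kernel from $S\times A$ to $S$, $c:S\times A\to\mathbb R$ bounded and measurable, $\gamma\in[0,1)$, $\tau>0$, and $\mu(da)=e^{-U(a)}\lambda(da)$ a probability measure on $A$ with $U\in C^1(\mathbb R^d)$. For a (possibly history-dependent) stochastic policy $\pi=(\pi_n)_{n\ge0}$ put $$V^\pi(s)=\mathbb E^\pi_s\Big[\sum_{n\ge 0}\gamma^n\big(c(s_n,a_n)+\tau\,\mathrm{KL}(\pi_n(\cdot|h_n)\,|\,\mu)\big)\Big]\in\mathbb R\cup\{\infty\},\qquad V^*(s)=\inf_\pi V^\pi(s),$$ where $h_n=(s_0,a_0,\dots,s_{n-1},a_{n-1},s_n)$. A kernel $\pi(da|s)$ is identified with the stationary Markov policy it defines; for it let $V^\pi(\rho)=\int V^\pi d\rho$, $Q^\pi(s,a)=c(s,a)+\gamma\int V^\pi(s')P(ds'|s,a)$, $P_\pi(ds'|s)=\int P(ds'|s,a)\pi(da|s)$, $d^\pi_\rho=(1-\gamma)\sum_{n\ge0}\gamma^n\rho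 P_\pi^n$, $\frac{\delta V^\pi}{\delta\pi}(s,a)=Q^\pi(s,a)+\tau\ln\frac{d\pi}{d\mu}(a|s)-V^\pi(s)$, and let the proximal policy $\Phi[\pi](\cdot|s)$ be the minimiser of $m\mapsto\int Q^\pi(s,a)\,m(da)+\tau\,\mathrm{KL}(m|\mu)$ over all probability measures $m$ on $A$. Write $\|\cdot\|$ for supremum norms. **Assumption (regular flow).** $(\pi_t)_{t\ge0}$ are probability kernels from $S$ to $A$ with densities $p_t(a|s)=\frac{d\pi_t}{d\lambda}(a|s)$ such that: 1. $\pi_t(da|s)=\frac{e^{f_t(s,a)}}{\int e^{f_t(s,a')}\mu(da')}\mu(da)$ for all $t\ge0$, with measurable $f_t$ satisfying $\sup_{0\le t\le T}\|f_t\|<\infty$ for every $T$; and $p_t(\cdot|s)\to p_0(\cdot|s)$ in $L^1(\lambda)$ as $t\downarrow0$, for every $s$. 2. For every $s$, $(a,t)\mapsto p_t(a|s)$ is in $C^{2,1}(A\times(0,\infty))$; for every $t>0$, $Q^{\pi_t}(s,\cdot)$ is $C^1$, the vector field $p_t\nabla_aQ^{\pi_t}+\tau p_t\nabla_aU$ is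 differentiable in $a$, and $$\partial_tp_t=\nabla_a\cdot\big(p_t\nabla_aQ^{\pi_t}+\tau p_t\nabla_aU\big)+\tau\Delta_ap_t .$$ 3. For every $s$ and every $0<t_0\le t_1$ there are $K,\delta>0$ such that for all $t\in[t_0,t_1]$ and $a\in A$, $$|p_t(a|s)|+|\partial_tp_t(a|s)|+|\nabla_ap_t(a|s)|\le K\,t^{(-d+2)/2}\exp\big(-\tfrac1{2t}\delta|a|^2\big).$$ **Proposition (energy dissipation and log-Sobolev along the flow).** Under this assumption the following hold. (a) For every probability measure $\rho$ on $S$ put $$D_\rho(t)=\frac1{1-\gamma}\int_S\int_A\Big|\nabla_a\frac{\delta V^{\pi_t}}{\delta\pi}(s,a)\Big|^2p_t(a|s)\,\lambda(da)\,d^{\pi_t}_\rho(ds).$$ For every $t>0$ the inner integrals are finite, $t\mapsto V^{\pi_t}(\rho)$ is differentiable at $t$, and $\partial_tV^{\pi_t}(\rho)=-D_\rho(t)\le0$. Down to $t=0$ this holds in integrated form: for every $t\ge0$, $D_\rho$ is integrable on $[0,t]$ and $V^{\pi_t}(\rho)=V^{\pi_0}(\rho)-\int_0^tD_\rho(r)\,dr$;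 and if $D_\rho$ is (right-)continuous at $0$, then the right derivative of $V^{\pi_t}(\rho)$ at $t=0$ is $-D_\rho(0)$. (b) $\max(\|V^{\pi_0}\|,\|V^*\|)<\infty$, and for every $t\ge0$ $$\|V^{\pi_t}\|\le\max(\|V^{\pi_0}\|,\|V^*\|),\qquad \|Q^{\pi_t}\|\le\|c\|+\gamma\max(\|V^{\pi_0}\|,\|V^*\|).$$ (c) Suppose that $\mu$ satisfies a log-Sobolev inequality: for some $\alpha_0>0$, $\mathrm{KL}(\nu|\mu)\le\frac1{2\alpha_0}\int|\nabla\ln\frac{d\nu}{d\mu}|^2d\nu$ for all probability measures $\nu$ with a positive $C^1$ density with respect to $\mu$. Then there is $\alpha>0$ such that for all $t>0$ and $s\in S$ the minimiser $\Phi[\pi_t](\cdot|s)$ exists and is unique, $\pi_t(\cdot|s)$ has a positive $C^1$ density with respect to it, and $$\mathrm{KL}(\pi_t|\Phi[\pi_t])(s)\le\frac1{2\alpha}\int_A\Big|\nabla_a\ln\frac{d\pi_t}{d\Phi[\pi_t]}(s,a)\Big|^2\pi_t(da|s).$$ -/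

import Mathlib

open MeasureTheory ProbabilityTheory InformationTheory Filter Topology Set
open scoped ENNReal InnerProductSpace Gradient

noncomputable section

/-! ### Entropy-regularised Markov decision processes -/

/-- The data of an entropy-regularised Markov decision process: transition kernel, bounded cost,
discount factor, reference probability measure on the actions, regularisation parameter. -/
structure EntropyMDP (S A : Type*) [MeasurableSpace S] [MeasurableSpace A] where
  P : Kernel (S × A) S
  markov_P : IsMarkovKernel P
  c : S × A → ℝ
  measurable_c : Measurable c
  bounded_c : ∃ B : ℝ, ∀ x, |c x| ≤ B
  γ : ℝ
  γ_nonneg : 0 ≤ γ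
  γ_lt_one : γ < 1
  μ : Measure A
  prob_μ : IsProbabilityMeasure μ
  τ : ℝ
  τ_pos : 0 < τ

/-- A (possibly non-Markovian) stochastic policy: for each `n`, a Markov kernel from the histories
`(s₀, a₀, …, s_{n-1}, a_{n-1}, s_n)` to the actions. -/
structure HistoryPolicy (S A : Type*) [MeasurableSpace S] [MeasurableSpace A] where
  act : (n : ℕ) → Kernel ((Fin n → S × A) × S) A
  markov_act : ∀ n, IsMarkovKernel (act n)

attribute [instance] EntropyMDP.markov_P EntropyMDP.prob_μ HistoryPolicy.markov_act

/-- A Markov kernel from states to actions, seen as a stationary Markov policy. -/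
def stationaryPolicy {S A : Type*} [MeasurableSpace S] [MeasurableSpace A]
    (κ : Kernel S A) [IsMarkovKernel κ] : HistoryPolicy S A where
  act n := κ.comap Prod.snd measurable_snd
  markov_act n := inferInstance

/-- The history `(s₀, a₀, …, s_n, a_n, s')` from the first `n + 1` state-action pairs and `s'`. -/
def extendHistory {S A : Type*} {n : ℕ} (x : (Finset.Iic n → S × A) × S) :
    (Fin (n + 1) → S × A) × S :=
  (fun i => x.1 ⟨i, Finset.mem_Iic.2 (Nat.le_of_lt_succ i.2)⟩, x.2)

theorem measurable_extendHistory {S A : Type*} [MeasurableSpace S] [MeasurableSpace A] (n : ℕ) :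
    Measurable (extendHistory (S := S) (A := A) (n := n)) := by
  unfold extendHistory
  fun_prop

/-- The history `(s₀, a₀, …, s_{n-1}, a_{n-1}, s_n)` of a trajectory. -/
def historyAt {S A : Type*} (n : ℕ) (ω : ℕ → S × A) : (Fin n → S × A) × S :=
  (fun i => ω i, (ω n).1)

/-- The supremum norm, in `[0, ∞]`, of an extended-real-valued function. -/
def supNorm {X : Type*} (f : X → EReal) : ℝ≥0∞ := ⨆ x, (f x).abs

/-- The Boltzmann policy `e^{f(s,a)} / (∫ e^{f(s,a')} μ(da')) μ(da)`. -/
def boltzmann {S A : Type*} [MeasurableSpace A] (μ : Measure A) (f : S → A → ℝ) (s : S) :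
    Measure A :=
  μ.withDensity fun a => ENNReal.ofReal (Real.exp (f s a) / ∫ a', Real.exp (f s a') ∂μ)

namespace EntropyMDP

variable {S A : Type*} [MeasurableSpace S] [MeasurableSpace A] (M : EntropyMDP S A)

/-- The law of `(s_{n+1}, a_{n+1})` given `(s₀, a₀, …, s_n, a_n)`: first `s_{n+1} ∼ P(· | s_n, a_n)`,
then `a_{n+1}` from the policy given the history. -/
def stepKernel (π : HistoryPolicy S A) (n : ℕ) : Kernel (Finset.Iic n → S × A) (S × A) :=
  (M.P.comap (fun h : Finset.Iic n → S × A => h ⟨n, Finset.mem_Iic.2 le_rfl⟩)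
      (measurable_pi_apply _)) ⊗ₖ
    ((π.act (n + 1)).comap extendHistory (measurable_extendHistory n))

instance (π : HistoryPolicy S A) (n : ℕ) : IsMarkovKernel (M.stepKernel π n) := by
  unfold stepKernel
  infer_instance

/-- The law of `(s₀, a₀)` when `s₀ = s`. -/
def initialLaw (π : HistoryPolicy S A) (s : S) : Measure (S × A) :=
  (Measure.dirac s) ⊗ₘ
    ((π.act 0).comap (fun s' : S => ((Fin.elim0 : Fin 0 → S × A), s')) measurable_prodMk_left)

/-- The law of the trajectory `(s₀, a₀, s₁, a₁, …)` under the policy `π` when `s₀ = s`. -/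
def pathLaw (π : HistoryPolicy S A) (s : S) : Measure (ℕ → S × A) :=
  Kernel.trajMeasure (X := fun _ : ℕ => S × A) (initialLaw π s) (M.stepKernel π)

/-- The regularised value function
`V^π(s) = E_s^π [ ∑ₙ γⁿ (c(sₙ,aₙ) + τ KL(πₙ(·|hₙ) | μ)) ]` with values in `ℝ ∪ {∞}`; the bounded
cost part and the nonnegative entropy part are integrated separately. -/
def value (π : HistoryPolicy S A) (s : S) : EReal :=
  ((∫ ω, ∑' n : ℕ, M.γ ^ n * M.c (ω n) ∂(M.pathLaw π s) : ℝ) : EReal) +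
  ((∫⁻ ω, ∑' n : ℕ, ENNReal.ofReal (M.γ ^ n * M.τ) * klDiv (π.act n (historyAt n ω)) M.μ
      ∂(M.pathLaw π s) : ℝ≥0∞) : EReal)

/-- The optimal value function: the infimum over all policies. -/
def optValue (s : S) : EReal := ⨅ π : HistoryPolicy S A, M.value π s

/-- The value function of a stationary Markov policy. -/
def V (κ : Kernel S A) [IsMarkovKernel κ] (s : S) : EReal := M.value (stationaryPolicy κ) s

/-- The value function of a stationary Markov policy averaged over an initial distribution. -/
def Vavg (κ : Kernel S A) [IsMarkovKernel κ] (ρ : Measure S) : ℝ := ∫ s, (M.V κ s).toReal ∂ρ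

/-- The `Q`-function of a stationary Markov policy. -/
def Q (κ : Kernel S A) [IsMarkovKernel κ] (s : S) (a : A) : ℝ :=
  M.c (s, a) + M.γ * ∫ s', (M.V κ s').toReal ∂(M.P (s, a))

/-- The state transition kernel `P_π(ds'|s) = ∫ P(ds'|s,a) π(da|s)`. -/
def stateKernel (κ : Kernel S A) : Kernel S S := M.P ∘ₖ (Kernel.id ×ₖ κ)

/-- The occupancy kernel `d^π(·|s) = (1-γ) ∑ₙ γⁿ P_πⁿ(·|s)`. -/
def occupancy (κ : Kernel S A) (s : S) : Measure S :=
  Measure.sum fun n : ℕ => ENNReal.ofReal ((1 - M.γ) * M.γ ^ n) • (M.stateKernel κ ^ n) s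

/-- The occupancy measure `d^π_ρ(ds) = ∫ d^π(ds|s') ρ(ds')`. -/
def occupancyAvg (κ : Kernel S A) (ρ : Measure S) : Measure S := ρ.bind (M.occupancy κ)

/-- The flat derivative `δV^π/δπ (s,a) = Q^π(s,a) + τ ln (dπ/dμ)(a|s) - V^π(s)`, where `h` is the
version of the density `dπ/dμ` that is used. -/
def flatDeriv (κ : Kernel S A) [IsMarkovKernel κ] (h : S → A → ℝ) (s : S) (a : A) : ℝ :=
  M.Q κ s a + M.τ * Real.log (h s a) - (M.V κ s).toReal

/-- The objective `m ↦ ∫ Q^π(s,a) m(da) + τ KL(m | μ)` of the proximal step. -/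
def proxObjective (κ : Kernel S A) [IsMarkovKernel κ] (s : S) (m : Measure A) : EReal :=
  ((∫ a, M.Q κ s a ∂m : ℝ) : EReal) + ((ENNReal.ofReal M.τ * klDiv m M.μ : ℝ≥0∞) : EReal)

/-- `m` is a minimiser over all probability measures of the objective of the proximal step, that is
a value at `s` of the proximal policy `Φ[π]`. -/
def IsProximal (κ : Kernel S A) [IsMarkovKernel κ] (s : S) (m : Measure A) : Prop :=
  IsProbabilityMeasure m ∧
    ∀ m' : Measure A, IsProbabilityMeasure m' → M.proxObjective κ s m ≤ M.proxObjective κ s m'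

end EntropyMDP

/-! ### Analysis on the action space -/

/-- The divergence of a vector field on `ℝᵈ`. -/
def divergence {d : ℕ} (F : EuclideanSpace ℝ (Fin d) → EuclideanSpace ℝ (Fin d))
    (a : EuclideanSpace ℝ (Fin d)) : ℝ :=
  ∑ i, (fderiv ℝ F a (EuclideanSpace.single i 1)) i

/-- The probability measure `h μ` with density `h`. -/
def densityMeasure {A : Type*} [MeasurableSpace A] (μ : Measure A) (h : A → ℝ) : Measure A :=
  μ.withDensity fun a => ENNReal.ofReal (h a)

/-- The relative Fisher information `∫ |∇ ln r|² dν` of a measure `ν` with density `r`. -/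
def fisherInfo {d : ℕ} (ν : Measure (EuclideanSpace ℝ (Fin d)))
    (r : EuclideanSpace ℝ (Fin d) → ℝ) : ℝ≥0∞ :=
  ∫⁻ a, ENNReal.ofReal (‖∇ (fun x => Real.log (r x)) a‖ ^ 2) ∂ν

/-- The log-Sobolev inequality with constant `α`: `KL(ν | μ) ≤ (1/(2α)) ∫ |∇ ln (dν/dμ)|² dν` for
all probability measures `ν` with a positive `C¹` density with respect to `μ`. -/
def LogSobolev {d : ℕ} (μ : Measure (EuclideanSpace ℝ (Fin d))) (α : ℝ) : Prop :=
  ∀ r : EuclideanSpace ℝ (Fin d) → ℝ, ContDiff ℝ 1 r → (∀ a, 0 < r a) →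
    IsProbabilityMeasure (densityMeasure μ r) →
      klDiv (densityMeasure μ r) μ ≤
        ENNReal.ofReal (1 / (2 * α)) * fisherInfo (densityMeasure μ r) r

/-- The class `C^{2,1}(ℝᵈ × (0,∞))`: twice differentiable in `a`, once in `t`, all these derivatives
being jointly continuous. -/
structure IsC21 {d : ℕ} (u : ℝ → EuclideanSpace ℝ (Fin d) → ℝ) : Prop where
  contDiff_space : ∀ t, 0 < t → ContDiff ℝ 2 (u t)
  differentiable_time : ∀ t, 0 < t → ∀ a, DifferentiableAt ℝ (fun r => u r a) t
  continuous_self : ContinuousOn (fun x : ℝ × EuclideanSpace ℝ (Fin d) => u x.1 x.2)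
    (Ioi 0 ×ˢ univ)
  continuous_time : ContinuousOn
    (fun x : ℝ × EuclideanSpace ℝ (Fin d) => deriv (fun r => u r x.2) x.1) (Ioi 0 ×ˢ univ)
  continuous_fderiv : ContinuousOn
    (fun x : ℝ × EuclideanSpace ℝ (Fin d) => fderiv ℝ (u x.1) x.2) (Ioi 0 ×ˢ univ)
  continuous_fderiv_two : ContinuousOn
    (fun x : ℝ × EuclideanSpace ℝ (Fin d) => iteratedFDeriv ℝ 2 (u x.1) x.2) (Ioi 0 ×ˢ univ)

/-! ### The Wasserstein gradient flow -/

/-- `π` is a regular solution, with Lebesgue densities `p t s a = (dπ_t/dλ)(a|s)`, of the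
Wasserstein gradient flow
`∂ₜ p = ∇ₐ·(p ∇ₐ Q^{π_t} + τ p ∇ₐ U) + τ Δₐ p` on `t > 0`, started at `π 0`. -/
structure IsWassersteinFlow {S : Type*} [MeasurableSpace S] {d : ℕ}
    (M : EntropyMDP S (EuclideanSpace ℝ (Fin d))) (U : EuclideanSpace ℝ (Fin d) → ℝ)
    (π : ℝ → Kernel S (EuclideanSpace ℝ (Fin d))) [∀ t, IsMarkovKernel (π t)]
    (p : ℝ → S → EuclideanSpace ℝ (Fin d) → ℝ) : Prop where
  measurable_density : ∀ t, 0 ≤ t → ∀ s, Measurable (p t s)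
  density : ∀ t, 0 ≤ t → ∀ s, π t s = densityMeasure volume (p t s)
  /-- the policies are Boltzmann policies, with potentials that are bounded on `S × A`, locally
  uniformly in time -/
  policy_class : ∀ T : ℝ, ∃ B : ℝ, ∀ t, 0 ≤ t → t ≤ T →
    ∃ f : S → EuclideanSpace ℝ (Fin d) → ℝ, Measurable (Function.uncurry f) ∧
      (∀ s a, |f s a| ≤ B) ∧ ∀ s, π t s = boltzmann M.μ f s
  /-- the initial condition is attained in `L¹(λ)` -/
  initial : ∀ s, Tendsto (fun t => ∫⁻ a, ‖p t s a - p 0 s a‖ₑ) (𝓝[>] 0) (𝓝 0)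
  regular : ∀ s, IsC21 fun t => p t s
  contDiff_Q : ∀ t, 0 < t → ∀ s, ContDiff ℝ 1 (M.Q (π t) s)
  differentiable_drift : ∀ t, 0 < t → ∀ s, Differentiable ℝ fun a =>
    p t s a • ∇ (M.Q (π t) s) a + (M.τ * p t s a) • ∇ U a
  equation : ∀ t, 0 < t → ∀ s a, deriv (fun r => p r s a) t =
    divergence (fun a' => p t s a' • ∇ (M.Q (π t) s) a' + (M.τ * p t s a') • ∇ U a') a +
      M.τ * Laplacian.laplacian (p t s) a
  /-- Gaussian bounds, on compact time intervals -/
  bounds : ∀ s, ∀ t₀ t₁ : ℝ, 0 < t₀ → t₀ ≤ t₁ → ∃ K δ : ℝ, 0 < K ∧ 0 < δ ∧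
    ∀ t, t₀ ≤ t → t ≤ t₁ → ∀ a,
      |p t s a| + |deriv (fun r => p r s a) t| + ‖∇ (p t s) a‖ ≤
        K * t ^ ((2 - (d : ℝ)) / 2) * Real.exp (-(1 / (2 * t)) * δ * ‖a‖ ^ 2)

/-- The flat derivative along the flow, `dπ_t/dμ = p_t e^U` being the version of the density. -/
def flowFlatDeriv {S : Type*} [MeasurableSpace S] {d : ℕ}
    (M : EntropyMDP S (EuclideanSpace ℝ (Fin d))) (U : EuclideanSpace ℝ (Fin d) → ℝ)
    (π : ℝ → Kernel S (EuclideanSpace ℝ (Fin d))) [∀ t, IsMarkovKernel (π t)]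
    (p : ℝ → S → EuclideanSpace ℝ (Fin d) → ℝ) (t : ℝ) (s : S) :
    EuclideanSpace ℝ (Fin d) → ℝ :=
  M.flatDeriv (π t) (fun s' a => p t s' a * Real.exp (U a)) s

/-- The dissipation
`(1-γ)⁻¹ ∫_S ∫_A |∇ₐ (δV^{π_t}/δπ)(s,a)|² p_t(a|s) λ(da) d^{π_t}_ρ(ds)`. -/
def dissipation {S : Type*} [MeasurableSpace S] {d : ℕ}
    (M : EntropyMDP S (EuclideanSpace ℝ (Fin d))) (U : EuclideanSpace ℝ (Fin d) → ℝ)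
    (π : ℝ → Kernel S (EuclideanSpace ℝ (Fin d))) [∀ t, IsMarkovKernel (π t)]
    (p : ℝ → S → EuclideanSpace ℝ (Fin d) → ℝ) (ρ : Measure S) (t : ℝ) : ℝ :=
  (1 - M.γ)⁻¹ * ∫ s, (∫ a, ‖∇ (flowFlatDeriv M U π p t s) a‖ ^ 2 * p t s a)
    ∂(M.occupancyAvg (π t) ρ)

end

/-!
A stationary policy `κ` of finite entropy has value function `V = T_κ V`, where the Bellman operator
`T_κ W = r_κ + γ P_κ W` is affine in `W`; equivalently `V = (1 - γ P_κ)⁻¹ r_κ`, a finite-dimensional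
resolvent which is integration against the occupancy measure up to the factor `1 - γ`
(`V_eq_resolvent`, `integral_occupancyAvg`). Subtracting two Bellman equations gives the performance
difference formula `V' - V = (1 - γ P_κ)⁻¹ (T_κ' V' - T_κ V')` (`V_sub_V`), so that time derivatives
of the Bellman operators at a fixed `W` determine those of the value functions (`hasDerivAt_V`).

Along the flow `T_{π_t} W (s)` is the integral of `(c + γ ∫ W dP) p_t + τ p_t ln (p_t e^U)`. The
Gaussian bounds and the two-sided bounds on `p_t e^U = dπ_t/dμ` allow differentiation under the
integral sign, and at `W = V^{π_t}` the derivative is `∫ F ∂ₜp_t` with `F` the flat derivative. The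
evolution equation reads `∂ₜp_t = ∇·(p_t ∇F)`, so this is `-∫ |∇F|² p_t`. The integration by parts
needs no growth condition on `∇F`: `F` is bounded and `p_t`, `∂ₜp_t` are integrable, and this is
enough for a Caccioppoli argument with cutoffs (`integrable_and_integral_mul_divergence_gradient`).
At `t = 0` the Bellman operators are continuous because their integrands are Lipschitz functions of
the density and `p_t → p_0` in `L¹`; since the dissipation is nonnegative, the fundamental theorem of
calculus then gives its integrability and the integrated identity.

The uniform bounds follow from `V^* ≤ V^{π_t} ≤ V^{π_0}`. In particular `Q^{π_t}` is bounded
uniformly in `t`. The proximal policy is the Gibbs measure `e^{-Q/τ} μ / Z` (`isProximal_iff`), a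
perturbation of `μ` by a uniformly bounded potential, so the log-Sobolev inequality for `μ` passes to
it with a constant independent of `t`, by the Holley–Stroock argument (`LogSobolev.tilted`).
-/

/-! ### Law of the state-action pairs under a stationary policy -/

/-- The law of the initial point of a trajectory is the initial distribution. -/
theorem map_eval_zero_trajMeasure {X : Type*} [MeasurableSpace X] (μ₀ : Measure X)
    [IsProbabilityMeasure μ₀] (κ : (n : ℕ) → Kernel (Finset.Iic n → X) X)
    [∀ n, IsMarkovKernel (κ n)] :
    (Kernel.trajMeasure (X := fun _ : ℕ => X) μ₀ κ).map (fun ω => ω 0) = μ₀ := by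
  have h : (Kernel.trajMeasure (X := fun _ : ℕ => X) μ₀ κ).map (Preorder.frestrictLe 0) =
      μ₀.map (MeasurableEquiv.piUnique fun _ : Finset.Iic 0 => X).symm := by
    rw [Kernel.trajMeasure, Measure.map_comp _ _ (by fun_prop), Kernel.traj_map_frestrictLe,
      Kernel.partialTraj_self, Measure.id_comp]
  have h2 := congrArg (fun m => Measure.map (fun x : Finset.Iic 0 → X =>
    x ⟨0, Finset.mem_Iic.2 le_rfl⟩) m) h
  rw [Measure.map_map (by fun_prop) (by fun_prop), Measure.map_map (by fun_prop) (by fun_prop)] at h2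
  refine Eq.trans ?_ (h2.trans ?_)
  · rfl
  · exact Measure.map_id

namespace EntropyMDP

variable {S A : Type*} [MeasurableSpace S] [MeasurableSpace A] (M : EntropyMDP S A)

instance (π : HistoryPolicy S A) (s : S) : IsProbabilityMeasure (initialLaw π s) := by
  unfold initialLaw; infer_instance

instance (π : HistoryPolicy S A) (s : S) : IsProbabilityMeasure (M.pathLaw π s) := by
  unfold pathLaw; infer_instance

instance (κ : Kernel S A) [IsMarkovKernel κ] : IsMarkovKernel (M.stateKernel κ) := by
  unfold stateKernel; infer_instance

instance isMarkovKernel_stateKernel_pow (κ : Kernel S A) [IsMarkovKernel κ] (n : ℕ) :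
    IsMarkovKernel (M.stateKernel κ ^ n) := by
  induction n with
  | zero => rw [pow_zero]; exact inferInstanceAs (IsMarkovKernel Kernel.id)
  | succ n ih => rw [pow_succ]; exact inferInstanceAs (IsMarkovKernel (_ ∘ₖ _))

theorem lintegral_stateKernel (κ : Kernel S A) [IsMarkovKernel κ] (s : S) {f : S → ℝ≥0∞}
    (hf : Measurable f) :
    ∫⁻ s', f s' ∂(M.stateKernel κ s) = ∫⁻ a, ∫⁻ s', f s' ∂(M.P (s, a)) ∂(κ s) := by
  have hm : Measurable fun x : S × A => ∫⁻ s', f s' ∂(M.P x) := hf.lintegral_kernel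
  rw [stateKernel, Kernel.lintegral_comp _ _ _ hf, Kernel.lintegral_prod _ _ _ hm]
  simp only [Kernel.id_apply]
  rw [lintegral_dirac' _ hm.lintegral_prod_right']

theorem map_eval_pathLaw_zero (κ : Kernel S A) [IsMarkovKernel κ] (s : S) :
    (M.pathLaw (stationaryPolicy κ) s).map (fun ω => ω 0) = (Measure.dirac s) ⊗ₘ κ := by
  rw [pathLaw, map_eval_zero_trajMeasure]
  rfl

theorem map_eval_pathLaw_succ (κ : Kernel S A) [IsMarkovKernel κ] (s : S) (n : ℕ) :
    (M.pathLaw (stationaryPolicy κ) s).map (fun ω => ω (n + 1)) =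
      ((M.pathLaw (stationaryPolicy κ) s).map (fun ω => ω n)).bind
        (M.P ⊗ₖ κ.comap Prod.snd measurable_snd) := by
  have h := congrArg Measure.snd (Kernel.map_frestrictLe_trajMeasure_compProd_eq_map_trajMeasure
    (X := fun _ : ℕ => S × A) (μ₀ := initialLaw (stationaryPolicy κ) s)
    (κ := M.stepKernel (stationaryPolicy κ)) (a := n))
  rw [Measure.snd_compProd, Measure.snd, Measure.map_map (by fun_prop) (by fun_prop)] at h
  refine h.symm.trans ?_
  have hk : M.stepKernel (stationaryPolicy κ) n =
      (M.P ⊗ₖ κ.comap Prod.snd measurable_snd).comap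
        (fun h : Finset.Iic n → S × A => h ⟨n, Finset.mem_Iic.2 le_rfl⟩)
        (measurable_pi_apply _) := by
    ext x t ht
    rw [stepKernel, Kernel.compProd_apply ht, Kernel.comap_apply, Kernel.comap_apply,
      Kernel.compProd_apply ht]
    rfl
  change Measure.bind (Measure.map (Preorder.frestrictLe n)
    (M.pathLaw (stationaryPolicy κ) s)) _ = _
  rw [hk]
  ext t ht
  rw [Measure.bind_apply ht (Kernel.aemeasurable _), Measure.bind_apply ht (Kernel.aemeasurable _),
    lintegral_map (Kernel.measurable_coe _ ht) (by fun_prop),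
    lintegral_map (Kernel.measurable_coe _ ht) (by fun_prop)]
  rfl

/-- Under a stationary policy `κ`, the `n`-th state has law `P_κⁿ(·|s)`, and the `n`-th action is
drawn from `κ` given that state. -/
theorem map_eval_pathLaw (κ : Kernel S A) [IsMarkovKernel κ] (s : S) (n : ℕ) :
    (M.pathLaw (stationaryPolicy κ) s).map (fun ω => ω n) = ((M.stateKernel κ ^ n) s) ⊗ₘ κ := by
  induction n with
  | zero =>
    rw [map_eval_pathLaw_zero, pow_zero]
    rfl
  | succ n ih =>
    rw [map_eval_pathLaw_succ, ih, pow_succ']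
    have hid : (M.stateKernel κ * M.stateKernel κ ^ n) s
      = ((M.stateKernel κ ^ n) s).bind (M.stateKernel κ) := rfl
    rw [hid]
    refine Measure.ext_of_lintegral _ fun f hf => ?_
    have hm : Measurable fun s' => ∫⁻ a, f (s', a) ∂(κ s') :=
      Measurable.lintegral_kernel_prod_right' (κ := κ) hf
    rw [Measure.lintegral_bind (Kernel.aemeasurable _) hf.aemeasurable,
      Measure.lintegral_compProd hf, Measure.lintegral_compProd hf.lintegral_kernel,
      Measure.lintegral_bind (Kernel.aemeasurable _) hm.aemeasurable]
    refine lintegral_congr fun s' => ?_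
    rw [lintegral_stateKernel _ _ _ hm]
    refine lintegral_congr fun a => ?_
    rw [Kernel.lintegral_compProd _ _ _ hf]
    rfl

end EntropyMDP

/-! ### The value function of a stationary policy -/

theorem abs_integral_le_of_forall_abs_le {X : Type*} [MeasurableSpace X] (ν : Measure X)
    [IsProbabilityMeasure ν] {u : X → ℝ} {C : ℝ} (hu : ∀ x, |u x| ≤ C) :
    |∫ x, u x ∂ν| ≤ C := by
  have := norm_integral_le_of_norm_le_const (μ := ν) (f := u) (ae_of_all _ hu)
  simpa using this

theorem exists_forall_abs_le {S : Type*} [Fintype S] (u : S → ℝ) : ∃ C, 0 ≤ C ∧ ∀ s, |u s| ≤ C :=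
  ⟨∑ s, |u s|, Finset.sum_nonneg fun _ _ => abs_nonneg _, fun s =>
    Finset.single_le_sum (f := fun s => |u s|) (fun _ _ => abs_nonneg _) (Finset.mem_univ s)⟩

namespace EntropyMDP

section BellmanEquation

variable {S A : Type*} [MeasurableSpace S] [MeasurableSpace A] (M : EntropyMDP S A)

/-- The expected one-step cost `∫ c(s,a) κ(da|s) + τ KL(κ(·|s) | μ)` of a policy with finite
entropy; the divergence is read through `ENNReal.toReal`. -/
noncomputable def stageCost (κ : Kernel S A) (s : S) : ℝ :=
  (∫ a, M.c (s, a) ∂(κ s)) + M.τ * (klDiv (κ s) M.μ).toReal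

/-- The discounted sum `∑ₙ γⁿ ∫ u d(P_κⁿ(·|s))`, that is `((1 - γ P_κ)⁻¹ u)(s)`. -/
noncomputable def resolvent (κ : Kernel S A) (u : S → ℝ) (s : S) : ℝ :=
  ∑' n : ℕ, M.γ ^ n * ∫ s', u s' ∂((M.stateKernel κ ^ n) s)

/-- The Bellman operator `(T_κ W)(s) = ∫ (c(s,a) + γ ∫ W dP(·|s,a)) κ(da|s) + τ KL(κ(·|s) | μ)`. -/
noncomputable def bellman (κ : Kernel S A) (W : S → ℝ) (s : S) : ℝ :=
  (∫ a, (M.c (s, a) + M.γ * ∫ s', W s' ∂(M.P (s, a))) ∂(κ s)) +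
    M.τ * (klDiv (κ s) M.μ).toReal

theorem summable_geometric : Summable fun n : ℕ => M.γ ^ n :=
  summable_geometric_of_lt_one M.γ_nonneg M.γ_lt_one

variable {M} in
theorem integrable_cost (ν : Measure A) [IsFiniteMeasure ν] (s : S) :
    Integrable (fun a => M.c (s, a)) ν := by
  obtain ⟨B, hB⟩ := M.bounded_c
  exact Integrable.of_bound
    (M.measurable_c.comp measurable_prodMk_left).aestronglyMeasurable B
    (ae_of_all _ fun a => hB (s, a))

theorem norm_tsum_cost_le {B : ℝ} (hB : ∀ x, |M.c x| ≤ B) (ω : ℕ → S × A) :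
    ‖∑' n : ℕ, M.γ ^ n * M.c (ω n)‖ ≤ B * (1 - M.γ)⁻¹ := by
  rw [← tsum_geometric_of_lt_one M.γ_nonneg M.γ_lt_one, ← tsum_mul_left]
  refine tsum_of_norm_bounded (M.summable_geometric.mul_left B).hasSum fun n => ?_
  rw [norm_mul, norm_pow, Real.norm_of_nonneg M.γ_nonneg, mul_comm B]
  exact mul_le_mul_of_nonneg_left (hB _) (pow_nonneg M.γ_nonneg n)

/-- The value of every policy is bounded below, the entropy term being nonnegative. -/
theorem neg_le_value {B : ℝ} (hB : ∀ x, |M.c x| ≤ B) (π : HistoryPolicy S A) (s : S) :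
    ((-(B * (1 - M.γ)⁻¹) : ℝ) : EReal) ≤ M.value π s := by
  have h : |∫ ω, ∑' n : ℕ, M.γ ^ n * M.c (ω n) ∂(M.pathLaw π s)| ≤ B * (1 - M.γ)⁻¹ := by
    have := norm_integral_le_of_norm_le_const (μ := M.pathLaw π s)
      (ae_of_all _ (M.norm_tsum_cost_le hB))
    simpa using this
  unfold value
  refine le_trans (EReal.coe_le_coe_iff.2 (abs_le.1 h).1) ?_
  exact le_add_of_nonneg_right (EReal.coe_ennreal_nonneg _)

theorem summable_resolvent [Fintype S] (κ : Kernel S A) [IsMarkovKernel κ] (u : S → ℝ) (s : S) :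
    Summable fun n : ℕ => M.γ ^ n * ∫ s', u s' ∂((M.stateKernel κ ^ n) s) := by
  obtain ⟨C, -, hC⟩ := exists_forall_abs_le u
  refine Summable.of_norm_bounded (M.summable_geometric.mul_right C) fun n => ?_
  rw [norm_mul, norm_pow, Real.norm_of_nonneg M.γ_nonneg]
  exact mul_le_mul_of_nonneg_left (abs_integral_le_of_forall_abs_le _ hC)
    (pow_nonneg M.γ_nonneg n)

theorem isProbabilityMeasure_occupancy (κ : Kernel S A) [IsMarkovKernel κ] (s : S) :
    IsProbabilityMeasure (M.occupancy κ s) := by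
  constructor
  rw [occupancy, Measure.sum_apply _ MeasurableSet.univ]
  simp only [Measure.smul_apply, measure_univ, smul_eq_mul, mul_one]
  have h1 : 0 < 1 - M.γ := sub_pos.2 M.γ_lt_one
  rw [← ENNReal.ofReal_tsum_of_nonneg
    (fun n => mul_nonneg h1.le (pow_nonneg M.γ_nonneg n)) (M.summable_geometric.mul_left _),
    tsum_mul_left, tsum_geometric_of_lt_one M.γ_nonneg M.γ_lt_one, mul_inv_cancel₀ h1.ne',
    ENNReal.ofReal_one]

theorem integral_tsum_cost (κ : Kernel S A) [IsMarkovKernel κ] (s : S) :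
    ∫ ω, ∑' n : ℕ, M.γ ^ n * M.c (ω n) ∂(M.pathLaw (stationaryPolicy κ) s) =
      M.resolvent κ (fun s' => ∫ a, M.c (s', a) ∂(κ s')) s := by
  obtain ⟨B, hB⟩ := M.bounded_c
  have hm := M.measurable_c
  have hint : ∀ n : ℕ, Integrable (fun ω : ℕ → S × A => M.γ ^ n * M.c (ω n))
      (M.pathLaw (stationaryPolicy κ) s) := fun n =>
    have hmn : Measurable fun ω : ℕ → S × A => M.c (ω n) := hm.comp (measurable_pi_apply n)
    Integrable.const_mul (Integrable.of_bound hmn.aestronglyMeasurable B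
      (ae_of_all _ fun ω => hB (ω n))) _
  rw [← (hasSum_integral_of_summable_integral_norm hint ?_).tsum_eq]
  · refine tsum_congr fun n => ?_
    have hi : Integrable M.c (((M.stateKernel κ ^ n) s) ⊗ₘ κ) :=
      Integrable.of_bound hm.aestronglyMeasurable B (ae_of_all _ hB)
    rw [integral_const_mul, ← Measure.integral_compProd hi, ← M.map_eval_pathLaw κ s n,
      integral_map (measurable_pi_apply n).aemeasurable hm.aestronglyMeasurable]
  · refine Summable.of_nonneg_of_le (fun n => integral_nonneg fun _ => norm_nonneg _)
      (fun n => ?_) (M.summable_geometric.mul_right B)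
    refine (le_abs_self _).trans (abs_integral_le_of_forall_abs_le _ fun ω => ?_)
    rw [abs_norm, norm_mul, norm_pow, Real.norm_of_nonneg M.γ_nonneg]
    exact mul_le_mul_of_nonneg_left (hB _) (pow_nonneg M.γ_nonneg n)

variable [Fintype S] [MeasurableSingletonClass S]

theorem integral_stateKernel (κ : Kernel S A) [IsMarkovKernel κ] (u : S → ℝ) (s : S) :
    ∫ s', u s' ∂(M.stateKernel κ s) = ∫ a, ∫ s', u s' ∂(M.P (s, a)) ∂(κ s) := by
  have hm : StronglyMeasurable fun x : S × A => ∫ s', u s' ∂(M.P x) :=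
    StronglyMeasurable.integral_kernel (.of_discrete)
  rw [stateKernel, Kernel.integral_comp .of_finite, Kernel.prod_apply, Kernel.id_apply,
    Measure.dirac_prod, integral_map (by fun_prop) hm.aestronglyMeasurable]

theorem integral_stateKernel_pow_succ (κ : Kernel S A) [IsMarkovKernel κ] (u : S → ℝ) (s : S)
    (n : ℕ) :
    ∫ s', u s' ∂((M.stateKernel κ ^ (n + 1)) s) =
      ∫ s', ∫ s'', u s'' ∂((M.stateKernel κ ^ n) s') ∂(M.stateKernel κ s) := by
  have h := M.isMarkovKernel_stateKernel_pow κ (n + 1)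
  rw [pow_succ] at h ⊢
  exact Kernel.integral_comp (η := M.stateKernel κ ^ n) (κ := M.stateKernel κ) .of_finite

theorem resolvent_eq (κ : Kernel S A) [IsMarkovKernel κ] (u : S → ℝ) (s : S) :
    M.resolvent κ u s = u s + M.γ * ∫ s', M.resolvent κ u s' ∂(M.stateKernel κ s) := by
  have h0 : ∫ s', u s' ∂((M.stateKernel κ ^ 0) s) = u s := by
    rw [pow_zero]
    exact integral_dirac u s
  rw [resolvent, (M.summable_resolvent κ u s).tsum_eq_zero_add, h0, pow_zero, one_mul]
  congr 1
  have h1 : ∫ s', M.resolvent κ u s' ∂(M.stateKernel κ s) =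
      ∑' n : ℕ, ∫ s', M.γ ^ n * ∫ s'', u s'' ∂((M.stateKernel κ ^ n) s')
        ∂(M.stateKernel κ s) := by
    simp only [integral_fintype (μ := M.stateKernel κ s) Integrable.of_finite]
    rw [Summable.tsum_finsetSum fun s' _ => (M.summable_resolvent κ u s').const_smul _]
    refine Finset.sum_congr rfl fun s' _ => ?_
    rw [(M.summable_resolvent κ u s').tsum_const_smul]
    rfl
  rw [h1, ← tsum_mul_left]
  refine tsum_congr fun n => ?_
  rw [integral_const_mul, integral_stateKernel_pow_succ, pow_succ]
  ring

/-- The equation `w = u + γ P_κ w` determines `w`. -/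
theorem eq_resolvent (κ : Kernel S A) [IsMarkovKernel κ] {u w : S → ℝ}
    (h : ∀ s, w s = u s + M.γ * ∫ s', w s' ∂(M.stateKernel κ s)) : w = M.resolvent κ u := by
  set e : S → ℝ := fun s => w s - M.resolvent κ u s with he
  have hes : ∀ s, e s = M.γ * ∫ s', e s' ∂(M.stateKernel κ s) := fun s => by
    rw [he, integral_sub .of_finite .of_finite]
    simp only
    rw [M.resolvent_eq κ u s, h s]
    ring
  obtain ⟨C, -, hC⟩ := exists_forall_abs_le e
  have hn : ∀ n : ℕ, ∀ s, |e s| ≤ M.γ ^ n * C := by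
    intro n
    induction n with
    | zero => simpa using hC
    | succ n ih =>
      intro s
      rw [hes s, abs_mul, abs_of_nonneg M.γ_nonneg, pow_succ', mul_assoc]
      exact mul_le_mul_of_nonneg_left (abs_integral_le_of_forall_abs_le _ ih) M.γ_nonneg
  funext s
  have hlim : Tendsto (fun n : ℕ => M.γ ^ n * C) atTop (𝓝 0) := by
    simpa using (tendsto_pow_atTop_nhds_zero_of_lt_one M.γ_nonneg M.γ_lt_one).mul_const C
  have : |e s| ≤ 0 := ge_of_tendsto' hlim fun n => hn n s
  have := abs_nonpos_iff.1 this
  rw [he] at this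
  linarith

theorem integral_occupancy (κ : Kernel S A) [IsMarkovKernel κ] (u : S → ℝ) (s : S) :
    ∫ s', u s' ∂(M.occupancy κ s) = (1 - M.γ) * M.resolvent κ u s := by
  have := M.isProbabilityMeasure_occupancy κ s
  have h1 : 0 < 1 - M.γ := sub_pos.2 M.γ_lt_one
  have hint : Integrable u (M.occupancy κ s) := .of_finite
  rw [occupancy] at hint ⊢
  rw [integral_sum_measure hint, resolvent, ← tsum_mul_left]
  refine tsum_congr fun n => ?_
  rw [integral_smul_measure, ENNReal.toReal_ofReal
    (mul_nonneg h1.le (pow_nonneg M.γ_nonneg n)), smul_eq_mul, mul_assoc]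

theorem integral_occupancyAvg (κ : Kernel S A) [IsMarkovKernel κ] (ρ : Measure S)
    [IsProbabilityMeasure ρ] (u : S → ℝ) :
    ∫ s, u s ∂(M.occupancyAvg κ ρ) = (1 - M.γ) * ∫ s, M.resolvent κ u s ∂ρ := by
  have := fun s => M.isProbabilityMeasure_occupancy κ s
  let η : Kernel S S := ⟨M.occupancy κ, .of_discrete⟩
  have : IsMarkovKernel η := ⟨fun s => M.isProbabilityMeasure_occupancy κ s⟩
  have h : ∫ s, u s ∂(ρ.bind η) = ∫ s, ∫ s', u s' ∂(η s) ∂ρ :=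
    Kernel.integral_comp (η := η) (κ := Kernel.const Unit ρ) (a := ()) .of_finite
  refine h.trans ?_
  rw [← integral_const_mul]
  exact integral_congr_ae (ae_of_all _ fun s => M.integral_occupancy κ u s)

theorem lintegral_tsum_klDiv (κ : Kernel S A) [IsMarkovKernel κ]
    (hκ : ∀ s, klDiv (κ s) M.μ ≠ ⊤) (s : S) :
    ∫⁻ ω, ∑' n : ℕ, ENNReal.ofReal (M.γ ^ n * M.τ) *
        klDiv ((stationaryPolicy κ).act n (historyAt n ω)) M.μ
        ∂(M.pathLaw (stationaryPolicy κ) s) =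
      ENNReal.ofReal (M.resolvent κ (fun s' => M.τ * (klDiv (κ s') M.μ).toReal) s) := by
  have hd : Measurable fun s' : S => klDiv (κ s') M.μ := .of_discrete
  have hk : ∀ n (ω : ℕ → S × A), (stationaryPolicy κ).act n (historyAt n ω) = κ (ω n).1 :=
    fun _ _ => rfl
  simp only [hk]
  have hnn : ∀ n : ℕ, 0 ≤ M.γ ^ n * ∫ s', M.τ * (klDiv (κ s') M.μ).toReal
      ∂((M.stateKernel κ ^ n) s) := fun n =>
    mul_nonneg (pow_nonneg M.γ_nonneg n) (integral_nonneg fun _ =>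
      mul_nonneg M.τ_pos.le ENNReal.toReal_nonneg)
  have hdn : ∀ n : ℕ, Measurable fun ω : ℕ → S × A => klDiv (κ (ω n).1) M.μ := fun n =>
    hd.comp (measurable_fst.comp (measurable_pi_apply n))
  rw [lintegral_tsum fun n => ((hdn n).const_mul _).aemeasurable,
    resolvent, ENNReal.ofReal_tsum_of_nonneg hnn (M.summable_resolvent κ _ s)]
  refine tsum_congr fun n => ?_
  have hl : ∫⁻ ω, klDiv (κ (ω n).1) M.μ ∂(M.pathLaw (stationaryPolicy κ) s) =
      ∫⁻ s', klDiv (κ s') M.μ ∂((M.stateKernel κ ^ n) s) := by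
    rw [← lintegral_map (f := fun x : S × A => klDiv (κ x.1) M.μ) (g := fun ω : ℕ → S × A => ω n)
      (hd.comp measurable_fst) (measurable_pi_apply n), M.map_eval_pathLaw κ s n,
      Measure.lintegral_compProd (f := fun x : S × A => klDiv (κ x.1) M.μ)
        (hd.comp measurable_fst)]
    simp
  rw [lintegral_const_mul _ (hdn n), hl, integral_const_mul,
    integral_toReal hd.aemeasurable (ae_of_all _ fun s' => (hκ s').lt_top), ← mul_assoc,
    ENNReal.ofReal_mul (mul_nonneg (pow_nonneg M.γ_nonneg n) M.τ_pos.le), ENNReal.ofReal_toReal]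
  rw [lintegral_fintype]
  exact (ENNReal.sum_lt_top.2 fun s' _ =>
    ENNReal.mul_lt_top (hκ s').lt_top (measure_lt_top _ _)).ne

/-- The value function of a stationary policy of finite entropy is finite; it is the resolvent of
the one-step cost. -/
theorem V_eq_resolvent (κ : Kernel S A) [IsMarkovKernel κ]
    (hκ : ∀ s, klDiv (κ s) M.μ ≠ ⊤) (s : S) :
    M.V κ s = (M.resolvent κ (M.stageCost κ) s : EReal) := by
  have hnn : 0 ≤ M.resolvent κ (fun s' => M.τ * (klDiv (κ s') M.μ).toReal) s :=
    tsum_nonneg fun n => mul_nonneg (pow_nonneg M.γ_nonneg n) (integral_nonneg fun _ =>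
      mul_nonneg M.τ_pos.le ENNReal.toReal_nonneg)
  rw [V, value, M.integral_tsum_cost, M.lintegral_tsum_klDiv κ hκ, EReal.coe_ennreal_ofReal,
    max_eq_left hnn, ← EReal.coe_add, resolvent, resolvent,
    ← (M.summable_resolvent κ _ s).tsum_add (M.summable_resolvent κ _ s), resolvent]
  congr 1
  refine tsum_congr fun n => ?_
  rw [← mul_add, ← integral_add .of_finite .of_finite]
  rfl

theorem coe_toReal_V (κ : Kernel S A) [IsMarkovKernel κ]
    (hκ : ∀ s, klDiv (κ s) M.μ ≠ ⊤) (s : S) : ((M.V κ s).toReal : EReal) = M.V κ s := by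
  rw [M.V_eq_resolvent κ hκ s, EReal.toReal_coe]

theorem measurable_integral_P (W : S → ℝ) (s : S) :
    Measurable fun a => ∫ s', W s' ∂(M.P (s, a)) :=
  (StronglyMeasurable.integral_kernel (κ := M.P) (f := W) .of_discrete).measurable.comp
    measurable_prodMk_left

theorem integrable_integral_P (W : S → ℝ) (s : S) (ν : Measure A) [IsFiniteMeasure ν] :
    Integrable (fun a => ∫ s', W s' ∂(M.P (s, a))) ν := by
  obtain ⟨C, -, hC⟩ := exists_forall_abs_le W
  exact Integrable.of_bound (M.measurable_integral_P W s).aestronglyMeasurable C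
    (ae_of_all _ fun a => abs_integral_le_of_forall_abs_le _ hC)

theorem bellman_eq (κ : Kernel S A) [IsMarkovKernel κ] (W : S → ℝ) (s : S) :
    M.bellman κ W s = M.stageCost κ s + M.γ * ∫ s', W s' ∂(M.stateKernel κ s) := by
  rw [bellman, stageCost, integral_stateKernel, integral_add (integrable_cost _ _)
    ((M.integrable_integral_P W s _).const_mul _), integral_const_mul]
  ring

/-- **Bellman equation** for a stationary policy. -/
theorem bellman_V (κ : Kernel S A) [IsMarkovKernel κ]
    (hκ : ∀ s, klDiv (κ s) M.μ ≠ ⊤) (s : S) :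
    M.bellman κ (fun s' => (M.V κ s').toReal) s = (M.V κ s).toReal := by
  simp only [M.V_eq_resolvent κ hκ, EReal.toReal_coe]
  rw [M.bellman_eq, ← M.resolvent_eq]

/-- **Performance difference**: the difference of two value functions is the resolvent of one of
the policies, applied to the difference of the two Bellman operators at the value function of the
other policy. -/
theorem V_sub_V (κ κ' : Kernel S A) [IsMarkovKernel κ] [IsMarkovKernel κ']
    (hκ : ∀ s, klDiv (κ s) M.μ ≠ ⊤) (hκ' : ∀ s, klDiv (κ' s) M.μ ≠ ⊤) (s : S) :
    (M.V κ' s).toReal - (M.V κ s).toReal =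
      M.resolvent κ (fun s' => M.bellman κ' (fun x => (M.V κ' x).toReal) s' -
        M.bellman κ (fun x => (M.V κ' x).toReal) s') s := by
  refine congrFun (M.eq_resolvent κ (w := fun s => (M.V κ' s).toReal - (M.V κ s).toReal)
    fun s => ?_) s
  rw [integral_sub .of_finite .of_finite, M.bellman_V κ' hκ', M.bellman_eq κ]
  nth_rw 1 [← M.bellman_V κ hκ, M.bellman_eq κ]
  ring

/-- The resolvent is a linear map on the finite-dimensional space of functions on the states. -/
theorem resolvent_eq_sum (κ : Kernel S A) [IsMarkovKernel κ] (u : S → ℝ) (s : S) :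
    M.resolvent κ u s = ∑ s', (1 - M.γ)⁻¹ * (M.occupancy κ s).real {s'} * u s' := by
  have := M.isProbabilityMeasure_occupancy κ s
  have h1 : 0 < 1 - M.γ := sub_pos.2 M.γ_lt_one
  have h := M.integral_occupancy κ u s
  rw [integral_fintype .of_finite] at h
  rw [← inv_mul_cancel_left₀ h1.ne' (M.resolvent κ u s), ← h, Finset.mul_sum]
  exact Finset.sum_congr rfl fun s' _ => by rw [smul_eq_mul, mul_assoc]

theorem measurable_Q (κ : Kernel S A) [IsMarkovKernel κ] (s : S) : Measurable (M.Q κ s) :=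
  (M.measurable_c.comp measurable_prodMk_left).add
    ((M.measurable_integral_P (fun x => (M.V κ x).toReal) s).const_mul _)

end BellmanEquation

end EntropyMDP

/-! ### Integration by parts on `ℝᵈ` -/

section IntegrationByParts

variable {d : ℕ}

theorem integral_divergence_eq_zero {X : EuclideanSpace ℝ (Fin d) → EuclideanSpace ℝ (Fin d)}
    (hX : Differentiable ℝ X) (hc : HasCompactSupport X) (hdiv : Continuous (divergence X)) :
    ∫ a, divergence X a = 0 := by
  obtain _ | n := d
  · simp [divergence]
  let L : (Fin (n + 1) → ℝ) ≃L[ℝ] EuclideanSpace ℝ (Fin (n + 1)) :=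
    (EuclideanSpace.equiv (Fin (n + 1)) ℝ).symm
  have hL : MeasurePreserving L volume volume := PiLp.volume_preserving_toLp (Fin (n + 1))
  have hemb : MeasurableEmbedding L := L.toHomeomorph.measurableEmbedding
  rw [← hL.integral_comp hemb]
  let Y : (Fin (n + 1) → ℝ) → (Fin (n + 1) → ℝ) := fun x => L.symm (X (L x))
  let Y' : (Fin (n + 1) → ℝ) → (Fin (n + 1) → ℝ) →L[ℝ] (Fin (n + 1) → ℝ) := fun x =>
    (L.symm : EuclideanSpace ℝ (Fin (n + 1)) →L[ℝ] _) ∘L (fderiv ℝ X (L x)) ∘L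
      (L : (Fin (n + 1) → ℝ) →L[ℝ] _)
  have hY : ∀ x, HasFDerivAt Y (Y' x) x := fun x =>
    L.symm.hasFDerivAt.comp x ((hX (L x)).hasFDerivAt.comp x L.hasFDerivAt)
  have hYdiv : ∀ x, divergence X (L x) = ∑ i, Y' x (Pi.single i 1) i := fun x => by
    refine Finset.sum_congr rfl fun i _ => ?_
    rfl
  have hYc : HasCompactSupport Y :=
    (hc.comp_homeomorph L.toHomeomorph).comp_left (g := L.symm) (map_zero _)
  obtain ⟨R, hR⟩ := hYc.isCompact.isBounded.subset_closedBall (0 : Fin (n + 1) → ℝ)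
  set r : ℝ := max R 0 + 1 with hr
  have hr0 : 0 < r := by positivity
  -- `Y` vanishes where some coordinate is at least `r` in absolute value
  have hY0 : ∀ x : Fin (n + 1) → ℝ, ∀ i, r ≤ |x i| → x ∉ tsupport Y := fun x i hi hx => by
    have h1 := hR hx
    rw [mem_closedBall_zero_iff] at h1
    have h2 := norm_le_pi_norm x i
    rw [Real.norm_eq_abs] at h2
    have := le_max_left R 0
    linarith
  have hdiv0 : ∀ x, x ∉ Icc (fun _ => -r : Fin (n + 1) → ℝ) (fun _ => r) →
      divergence X (L x) = 0 := fun x hx => by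
    have : ∃ i, r ≤ |x i| := by
      by_contra! hcon
      exact hx ⟨fun i => (abs_lt.1 (hcon i)).1.le, fun i => (abs_lt.1 (hcon i)).2.le⟩
    obtain ⟨i, hi⟩ := this
    have hz : Y' x = 0 := by
      rw [← (hY x).fderiv]
      exact image_eq_zero_of_notMem_tsupport
        fun h => hY0 x i hi (tsupport_fderiv_subset ℝ h)
    rw [hYdiv, hz]
    simp
  rw [← setIntegral_eq_integral_of_forall_compl_eq_zero hdiv0]
  simp only [hYdiv]
  rw [integral_divergence_of_hasFDerivAt_off_countable _ _ (fun i => by simp; linarith) Y Y' ∅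
    countable_empty (fun x _ => (hY x).continuousAt.continuousWithinAt) (fun x _ => hY x)]
  · refine Finset.sum_eq_zero fun i _ => ?_
    have h1 : ∀ (c : ℝ), |c| = r → ∀ x : Fin n → ℝ, Y (i.insertNth c x) i = 0 := fun c hc' x => by
      rw [image_eq_zero_of_notMem_tsupport (hY0 _ i (by simp [hc']))]
      rfl
    simp only [h1 r (abs_of_pos hr0), h1 (-r) (by rw [abs_neg, abs_of_pos hr0])]
    simp
  · simp only [← hYdiv]
    exact (hdiv.comp L.continuous).continuousOn.integrableOn_compact isCompact_Icc

theorem divergence_smul {φ : EuclideanSpace ℝ (Fin d) → ℝ}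
    {X : EuclideanSpace ℝ (Fin d) → EuclideanSpace ℝ (Fin d)} {a : EuclideanSpace ℝ (Fin d)}
    (hφ : DifferentiableAt ℝ φ a) (hX : DifferentiableAt ℝ X a) :
    divergence (fun x => φ x • X x) a = φ a * divergence X a + fderiv ℝ φ a (X a) := by
  have h : fderiv ℝ φ a (X a) = ∑ i, X a i * fderiv ℝ φ a (EuclideanSpace.single i 1) := by
    conv_lhs => rw [← (EuclideanSpace.basisFun (Fin d) ℝ).sum_repr (X a)]
    simp [map_sum]
  rw [divergence, divergence, h, Finset.mul_sum, ← Finset.sum_add_distrib, fderiv_fun_smul hφ hX]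
  refine Finset.sum_congr rfl fun i _ => ?_
  simp
  ring

theorem integral_mul_divergence {φ : EuclideanSpace ℝ (Fin d) → ℝ}
    {X : EuclideanSpace ℝ (Fin d) → EuclideanSpace ℝ (Fin d)} (hφ : ContDiff ℝ 1 φ)
    (hc : HasCompactSupport φ) (hX : Differentiable ℝ X) (hdiv : Continuous (divergence X)) :
    ∫ a, φ a * divergence X a = - ∫ a, fderiv ℝ φ a (X a) := by
  have hφd : Differentiable ℝ φ := hφ.differentiable (by norm_num)
  have hφ' : Continuous (fderiv ℝ φ) := hφ.continuous_fderiv (by norm_num)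
  have hdivφ : ∀ a, divergence (fun x => φ x • X x) a =
      φ a * divergence X a + fderiv ℝ φ a (X a) := fun a => divergence_smul (hφd a) (hX a)
  have hcont1 : Continuous fun a => φ a * divergence X a := hφ.continuous.mul hdiv
  have hcont2 : Continuous fun a => fderiv ℝ φ a (X a) := hφ'.clm_apply hX.continuous
  have h := integral_divergence_eq_zero (X := fun x => φ x • X x) (hφd.smul hX) hc.smul_right
    (by rw [funext hdivφ]; exact hcont1.add hcont2)
  simp only [hdivφ] at h
  rw [integral_add (hcont1.integrable_of_hasCompactSupport hc.mul_right)
    (hcont2.integrable_of_hasCompactSupport ?_)] at h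
  · linarith
  · exact (hc.fderiv ℝ).mono' fun a ha => subset_tsupport _ fun h0 => ha (by simp [h0])

/-- Smooth cutoff functions at scale `n`, with gradients of order `1 / n`. -/
theorem exists_cutoff : ∃ (χ : ℕ → EuclideanSpace ℝ (Fin d) → ℝ) (C : ℝ), 0 ≤ C ∧
    (∀ n, ContDiff ℝ 1 (χ n)) ∧ (∀ n, HasCompactSupport (χ n)) ∧
    (∀ n a, 0 ≤ χ n a ∧ χ n a ≤ 1) ∧ (∀ (n : ℕ) (a), ‖a‖ ≤ n → χ n a = 1) ∧
    (∀ (n : ℕ) (a), ‖fderiv ℝ (χ n) a‖ ≤ C * (n + 1 : ℝ)⁻¹) := by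
  let f : ContDiffBump (0 : EuclideanSpace ℝ (Fin d)) := ⟨1, 2, one_pos, one_lt_two⟩
  obtain ⟨C, hC⟩ := f.hasCompactSupport.fderiv ℝ |>.exists_bound_of_continuous
    (f.contDiff.continuous_fderiv (n := 1) (by norm_num))
  refine ⟨fun n a => f ((n + 1 : ℝ)⁻¹ • a), C, (norm_nonneg _).trans (hC 0), fun n => ?_, fun n => ?_,
    fun n a => ⟨f.nonneg, f.le_one⟩, fun n a ha => ?_, fun n a => ?_⟩
  · exact f.contDiff.comp (contDiff_const_smul _)
  · exact f.hasCompactSupport.comp_homeomorph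
      (Homeomorph.smulOfNeZero ((n + 1 : ℝ)⁻¹) (by positivity))
  · refine f.one_of_mem_closedBall ?_
    rw [mem_closedBall_zero_iff, norm_smul, norm_inv, Real.norm_of_nonneg (by positivity)]
    refine (inv_mul_le_iff₀ (by positivity)).2 ?_
    change ‖a‖ ≤ (n + 1) * 1
    linarith
  · have hn : (0 : ℝ) < n + 1 := by positivity
    rw [fderiv_comp_smul, norm_smul, norm_inv, Real.norm_of_nonneg hn.le, mul_comm]
    exact mul_le_mul_of_nonneg_right (hC _) (by positivity)

theorem abs_fderiv_gradient_le {F G : EuclideanSpace ℝ (Fin d) → ℝ} (a : EuclideanSpace ℝ (Fin d)) :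
    |fderiv ℝ G a (∇ F a)| ≤ ‖fderiv ℝ G a‖ * ‖∇ F a‖ :=
  (fderiv ℝ G a).le_opNorm _

theorem fderiv_self_gradient {F : EuclideanSpace ℝ (Fin d) → ℝ} (a : EuclideanSpace ℝ (Fin d)) :
    fderiv ℝ F a (∇ F a) = ‖∇ F a‖ ^ 2 := by
  rw [← real_inner_self_eq_norm_sq, gradient, InnerProductSpace.toDual_symm_apply]

theorem continuous_gradient {F : EuclideanSpace ℝ (Fin d) → ℝ} (hF : ContDiff ℝ 1 F) :
    Continuous (∇ F) :=
  (InnerProductSpace.toDual ℝ _).symm.continuous.comp (hF.continuous_fderiv (by norm_num))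

/-- **Energy identity** for the drift `p ∇F` with a bounded potential `F` and a nonnegative
integrable `p`. Nothing is assumed on the growth of `∇F`: testing against `χₙ² F` for cutoffs `χₙ` and absorbing
the gradient as in Caccioppoli's inequality shows that the energy is finite, after which the error
terms vanish in the limit. -/
theorem integrable_and_integral_mul_divergence_gradient {F p : EuclideanSpace ℝ (Fin d) → ℝ} {C : ℝ}
    (hF : ContDiff ℝ 1 F) (hFC : ∀ a, |F a| ≤ C) (hp : Continuous p) (hp0 : ∀ a, 0 ≤ p a)
    (hpi : Integrable p) (hX : Differentiable ℝ fun a => p a • ∇ F a)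
    (hdiv : Continuous (divergence fun a => p a • ∇ F a))
    (hdivi : Integrable (divergence fun a => p a • ∇ F a)) :
    Integrable (fun a => ‖∇ F a‖ ^ 2 * p a) ∧
      ∫ a, F a * divergence (fun a => p a • ∇ F a) a = - ∫ a, ‖∇ F a‖ ^ 2 * p a := by
  obtain ⟨χ, K, hK, hχ, hχc, hχ01, hχ1, hχ'⟩ := exists_cutoff (d := d)
  have hC : 0 ≤ C := (abs_nonneg _).trans (hFC 0)
  set D := divergence fun a => p a • ∇ F a with hD
  have hFd : Differentiable ℝ F := hF.differentiable (by norm_num)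
  have hχd : ∀ n, Differentiable ℝ (χ n) := fun n => (hχ n).differentiable (by norm_num)
  have hF' := continuous_gradient hF
  have hχ'c : ∀ n, Continuous (fderiv ℝ (χ n)) := fun n => (hχ n).continuous_fderiv (by norm_num)
  have hGc : Continuous fun a => ‖∇ F a‖ ^ 2 * p a := (hF'.norm.pow 2).mul hp
  -- the error term in the integration by parts
  set e : ℕ → EuclideanSpace ℝ (Fin d) → ℝ := fun n a =>
    2 * χ n a * F a * fderiv ℝ (χ n) a (∇ F a) * p a with he
  have hec : ∀ n, Continuous (e n) := fun n =>
    (((continuous_const.mul (hχ n).continuous).mul hF.continuous).mul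
      ((hχ'c n).clm_apply hF')).mul hp
  have hcs : ∀ n (g : EuclideanSpace ℝ (Fin d) → ℝ), HasCompactSupport fun a => χ n a ^ 2 * g a :=
    fun n g => ((hχc n).comp_left (g := fun x : ℝ => x ^ 2) (by simp)).mul_right
  have hecs : ∀ n, HasCompactSupport (e n) := fun n => (hχc n).mono' fun a ha =>
    subset_tsupport _ fun h0 => ha (by simp [he, h0])
  have hderiv : ∀ n a, fderiv ℝ (fun x => χ n x ^ 2 * F x) a (p a • ∇ F a) =
      χ n a ^ 2 * (‖∇ F a‖ ^ 2 * p a) + e n a := fun n a => by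
    rw [fderiv_fun_mul (c := fun x => χ n x ^ 2) ((hχd n a).pow 2) (hFd a),
      fderiv_fun_pow 2 (hχd n a)]
    simp only [add_apply, smul_apply, map_smul, smul_eq_mul,
      fderiv_self_gradient, he]
    ring
  have hint1 : ∀ n, Integrable fun a => χ n a ^ 2 * (‖∇ F a‖ ^ 2 * p a) := fun n =>
    (((hχ n).continuous.pow 2).mul hGc).integrable_of_hasCompactSupport (hcs n _)
  have hint2 : ∀ n, Integrable (e n) := fun n => (hec n).integrable_of_hasCompactSupport (hecs n)
  have hibp : ∀ n, ∫ a, χ n a ^ 2 * F a * D a =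
      -(∫ a, (χ n a ^ 2 * (‖∇ F a‖ ^ 2 * p a) + e n a)) := fun n => by
    rw [integral_mul_divergence (((hχ n).pow 2).mul hF) (hcs n F) hX hdiv]
    simp only [hderiv]
  have hχK : ∀ n a, ‖fderiv ℝ (χ n) a‖ ≤ K := fun n a => (hχ' n a).trans <|
    mul_le_of_le_one_right hK (inv_le_one_of_one_le₀ (by linarith [n.cast_nonneg (α := ℝ)]))
  have heb : ∀ n a, |e n a| ≤ 2 * C * (χ n a * ‖fderiv ℝ (χ n) a‖ * ‖∇ F a‖) * p a := fun n a => by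
    simp only [he, abs_mul, abs_two, abs_of_nonneg (hχ01 n a).1, abs_of_nonneg (hp0 a)]
    refine mul_le_mul_of_nonneg_right ?_ (hp0 a)
    calc 2 * χ n a * |F a| * |fderiv ℝ (χ n) a (∇ F a)|
        ≤ 2 * χ n a * C * (‖fderiv ℝ (χ n) a‖ * ‖∇ F a‖) := by
          have := (hχ01 n a).1
          gcongr
          exacts [hFC a, abs_fderiv_gradient_le a]
      _ = _ := by ring
  -- the gradient part of the error is absorbed
  have heb1 : ∀ n a, |e n a| ≤
      1 / 2 * (χ n a ^ 2 * (‖∇ F a‖ ^ 2 * p a)) + 2 * C ^ 2 * K ^ 2 * p a := fun n a => by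
    refine (heb n a).trans ?_
    have h1 : 2 * C * (χ n a * ‖fderiv ℝ (χ n) a‖ * ‖∇ F a‖) ≤
        1 / 2 * (χ n a ^ 2 * ‖∇ F a‖ ^ 2) + 2 * C ^ 2 * K ^ 2 := by
      have h2 : ‖fderiv ℝ (χ n) a‖ ^ 2 ≤ K ^ 2 := pow_le_pow_left₀ (norm_nonneg _) (hχK n a) 2
      have h3 := mul_le_mul_of_nonneg_left h2 (sq_nonneg C)
      nlinarith [sq_nonneg (χ n a * ‖∇ F a‖ - 2 * C * ‖fderiv ℝ (χ n) a‖)]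
    calc _ ≤ (1 / 2 * (χ n a ^ 2 * ‖∇ F a‖ ^ 2) + 2 * C ^ 2 * K ^ 2) * p a :=
          mul_le_mul_of_nonneg_right h1 (hp0 a)
      _ = _ := by ring
  have hχsq : ∀ n a, χ n a ^ 2 ≤ 1 := fun n a => pow_le_one₀ (hχ01 n a).1 (hχ01 n a).2
  have hbound : ∀ n, ∫ a, χ n a ^ 2 * (‖∇ F a‖ ^ 2 * p a) ≤
      2 * (C * ∫ a, |D a|) + 2 * (2 * C ^ 2 * K ^ 2 * ∫ a, p a) := fun n => by
    have h1 := hibp n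
    rw [integral_add (hint1 n) (hint2 n)] at h1
    have h2 : |∫ a, χ n a ^ 2 * F a * D a| ≤ C * ∫ a, |D a| := by
      rw [← integral_const_mul, ← Real.norm_eq_abs]
      refine norm_integral_le_of_norm_le (hdivi.abs.const_mul C) (ae_of_all _ fun a => ?_)
      rw [norm_mul, norm_mul, Real.norm_of_nonneg (sq_nonneg _)]
      have := hFC a
      have := hχsq n a
      calc χ n a ^ 2 * |F a| * |D a| ≤ 1 * C * |D a| := by gcongr
        _ = _ := by ring
    have h3 : |∫ a, e n a| ≤ 1 / 2 * (∫ a, χ n a ^ 2 * (‖∇ F a‖ ^ 2 * p a)) +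
        2 * C ^ 2 * K ^ 2 * ∫ a, p a := by
      rw [← integral_const_mul, ← integral_const_mul,
        ← integral_add ((hint1 n).const_mul _) (hpi.const_mul _)]
      exact norm_integral_le_of_norm_le (f := e n)
        (((hint1 n).const_mul (1 / 2)).add (hpi.const_mul (2 * C ^ 2 * K ^ 2)))
        (ae_of_all _ (heb1 n))
    have := abs_le.1 h2
    have := abs_le.1 h3
    linarith
  have hG0 : ∀ a, 0 ≤ ‖∇ F a‖ ^ 2 * p a := fun a => mul_nonneg (sq_nonneg _) (hp0 a)
  have hG : Integrable fun a => ‖∇ F a‖ ^ 2 * p a := by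
    refine (aecover_closedBall (μ := volume) (x := (0 : EuclideanSpace ℝ (Fin d)))
      tendsto_natCast_atTop_atTop).integrable_of_integral_bounded_of_nonneg_ae _
      (fun n => (hGc.continuousOn.integrableOn_compact (isCompact_closedBall 0 (n : ℝ))))
      (ae_of_all _ hG0) (Eventually.of_forall fun n => le_trans ?_ (hbound n))
    rw [← integral_indicator measurableSet_closedBall]
    refine integral_mono ((hGc.continuousOn.integrableOn_compact
      (isCompact_closedBall 0 (n : ℝ))).integrable_indicator measurableSet_closedBall) (hint1 n) ?_
    intro a
    by_cases ha : a ∈ Metric.closedBall (0 : EuclideanSpace ℝ (Fin d)) (n : ℝ)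
    · simp only [indicator_of_mem ha, hχ1 n a (mem_closedBall_zero_iff.1 ha), one_pow, one_mul]
      exact le_rfl
    · simp only [indicator_of_notMem ha]
      exact mul_nonneg (sq_nonneg _) (hG0 a)
  refine ⟨hG, ?_⟩
  have hχlim : ∀ a, ∀ᶠ n : ℕ in atTop, χ n a = 1 := fun a => by
    filter_upwards [tendsto_natCast_atTop_atTop.eventually_ge_atTop ‖a‖] with n hn
    exact hχ1 n a hn
  have hl : Tendsto (fun n => ∫ a, χ n a ^ 2 * F a * D a) atTop (𝓝 (∫ a, F a * D a)) := by
    refine tendsto_integral_of_dominated_convergence (fun a => C * |D a|)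
      (fun n => ((((hχ n).continuous.pow 2).mul hF.continuous).mul hdiv).aestronglyMeasurable)
      (hdivi.abs.const_mul C) (fun n => ae_of_all _ fun a => ?_) (ae_of_all _ fun a => ?_)
    · rw [norm_mul, norm_mul, Real.norm_of_nonneg (sq_nonneg _)]
      have := hFC a
      have := hχsq n a
      calc χ n a ^ 2 * |F a| * |D a| ≤ 1 * C * |D a| := by gcongr
        _ = _ := by ring
    · refine tendsto_const_nhds.congr' ?_
      filter_upwards [hχlim a] with n hn
      rw [hn]
      ring
  have hr : Tendsto (fun n => ∫ a, (χ n a ^ 2 * (‖∇ F a‖ ^ 2 * p a) + e n a)) atTop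
      (𝓝 (∫ a, ‖∇ F a‖ ^ 2 * p a)) := by
    refine tendsto_integral_of_dominated_convergence
      (fun a => 3 / 2 * (‖∇ F a‖ ^ 2 * p a) + 2 * C ^ 2 * K ^ 2 * p a)
      (fun n => ((((hχ n).continuous.pow 2).mul hGc).add (hec n)).aestronglyMeasurable)
      ((hG.const_mul _).add (hpi.const_mul _)) (fun n => ae_of_all _ fun a => ?_)
      (ae_of_all _ fun a => ?_)
    · have h1 := mul_le_mul_of_nonneg_right (hχsq n a) (hG0 a)
      have h2 := heb1 n a
      refine (norm_add_le _ _).trans ?_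
      rw [Real.norm_of_nonneg (mul_nonneg (sq_nonneg _) (hG0 a)), Real.norm_eq_abs]
      linarith
    · have h1 : Tendsto (fun n => χ n a ^ 2 * (‖∇ F a‖ ^ 2 * p a)) atTop
          (𝓝 (‖∇ F a‖ ^ 2 * p a)) := by
        refine tendsto_const_nhds.congr' ?_
        filter_upwards [hχlim a] with n hn
        rw [hn]
        ring
      have h2 : Tendsto (fun n => e n a) atTop (𝓝 0) := by
        refine squeeze_zero_norm (a := fun n : ℕ => 2 * C * (K * (n + 1 : ℝ)⁻¹ * ‖∇ F a‖) * p a)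
          (fun n => (heb n a).trans ?_) ?_
        · have := (hχ01 n a).1
          have := (hχ01 n a).2
          refine mul_le_mul_of_nonneg_right (mul_le_mul_of_nonneg_left
            (mul_le_mul_of_nonneg_right ?_ (norm_nonneg _)) (by positivity)) (hp0 a)
          calc χ n a * ‖fderiv ℝ (χ n) a‖ ≤ 1 * ‖fderiv ℝ (χ n) a‖ := by gcongr
            _ ≤ _ := by rw [one_mul]; exact hχ' n a
        · have h3 : Tendsto (fun n : ℕ => (n + 1 : ℝ)⁻¹) atTop (𝓝 0) := by
            simpa [one_div] using tendsto_one_div_add_atTop_nhds_zero_nat (𝕜 := ℝ)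
          have := (((h3.const_mul K).mul_const ‖∇ F a‖).const_mul (2 * C)).mul_const (p a)
          simpa using this
      simpa using h1.add h2
  exact tendsto_nhds_unique hl (by simpa only [hibp] using hr.neg)

end IntegrationByParts

/-! ### Varying the policy -/

/-- A product of a function vanishing at `t` with a function continuous at `t` is differentiable as
soon as the first one is. -/
theorem HasDerivAt.continuousAt_mul_of_eq_zero {f g : ℝ → ℝ} {f' t : ℝ} (hf : HasDerivAt f f' t)
    (hft : f t = 0) (hg : ContinuousAt g t) : HasDerivAt (fun r => g r * f r) (g t * f') t := by
  rw [hasDerivAt_iff_tendsto_slope] at hf ⊢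
  refine ((hg.tendsto.mono_left nhdsWithin_le_nhds).mul hf).congr fun r => ?_
  simp only [slope_def_field, hft]
  ring

namespace EntropyMDP

section Variation

variable {S A : Type*} [MeasurableSpace S] [MeasurableSpace A] (M : EntropyMDP S A)

theorem abs_resolvent_le (κ : Kernel S A) [IsMarkovKernel κ] {u : S → ℝ} {C : ℝ}
    (hu : ∀ s, |u s| ≤ C) (s : S) : |M.resolvent κ u s| ≤ C * (1 - M.γ)⁻¹ := by
  rw [← tsum_geometric_of_lt_one M.γ_nonneg M.γ_lt_one, ← tsum_mul_left, ← Real.norm_eq_abs]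
  refine tsum_of_norm_bounded (M.summable_geometric.mul_left C).hasSum fun n => ?_
  rw [norm_mul, norm_pow, Real.norm_of_nonneg M.γ_nonneg, mul_comm C]
  exact mul_le_mul_of_nonneg_left (abs_integral_le_of_forall_abs_le _ hu)
    (pow_nonneg M.γ_nonneg n)

variable [Fintype S] [MeasurableSingletonClass S]

/-- The Bellman operator is affine. -/
theorem bellman_eq_sum [DecidableEq S] (κ : Kernel S A) [IsMarkovKernel κ] (W : S → ℝ) (s : S) :
    M.bellman κ W s = M.bellman κ 0 s +
      ∑ x, W x * (M.bellman κ (Pi.single x 1) s - M.bellman κ 0 s) := by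
  simp only [M.bellman_eq, integral_fintype (μ := M.stateKernel κ s) Integrable.of_finite]
  simp only [Pi.zero_apply, Finset.sum_const_zero, mul_zero, add_zero,
    add_sub_cancel_left, Pi.single_apply, smul_eq_mul, mul_ite, mul_one, Finset.sum_ite_eq',
    Finset.mem_univ, if_true]
  rw [Finset.mul_sum]
  exact congrArg _ (Finset.sum_congr rfl fun x _ => by ring)

theorem bellman_zero (κ : Kernel S A) [IsMarkovKernel κ] (s : S) :
    M.bellman κ 0 s = M.stageCost κ s := by
  simp [M.bellman_eq]

theorem bellman_sub_bellman [DecidableEq S] (κ κ' : Kernel S A) [IsMarkovKernel κ]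
    [IsMarkovKernel κ'] (W : S → ℝ) (s : S) :
    M.bellman κ' W s - M.bellman κ W s = (M.bellman κ' 0 s - M.bellman κ 0 s) +
      ∑ x, W x * ((M.bellman κ' (Pi.single x 1) s - M.bellman κ' 0 s) -
        (M.bellman κ (Pi.single x 1) s - M.bellman κ 0 s)) := by
  rw [M.bellman_eq_sum κ' W, M.bellman_eq_sum κ W]
  simp only [mul_sub, Finset.sum_sub_distrib]
  ring

/-- The value function depends continuously on the policy if the Bellman operators do. -/
theorem tendsto_V {π : ℝ → Kernel S A} [∀ t, IsMarkovKernel (π t)] {t : ℝ} {l : Filter ℝ}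
    (ht : ∀ s, klDiv (π t s) M.μ ≠ ⊤) (hl : ∀ᶠ r in l, ∀ s, klDiv (π r s) M.μ ≠ ⊤)
    (h : ∀ W s, Tendsto (fun r => M.bellman (π r) W s) l (𝓝 (M.bellman (π t) W s))) (s : S) :
    Tendsto (fun r => (M.V (π r) s).toReal) l (𝓝 (M.V (π t) s).toReal) := by
  classical
  obtain ⟨C, -, hC⟩ := exists_forall_abs_le (M.bellman (π t) 0)
  have hbdd : ∀ᶠ r in l, ∀ s, |(M.V (π r) s).toReal| ≤ (C + 1) * (1 - M.γ)⁻¹ := by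
    have h1 : ∀ᶠ r in l, ∀ s, |M.bellman (π r) 0 s| < C + 1 :=
      eventually_all.2 fun s => (h 0 s).abs.eventually_lt_const
        (lt_of_le_of_lt (hC s) (lt_add_one C))
    filter_upwards [h1, hl] with r hr hfin s
    rw [M.V_eq_resolvent _ hfin, EReal.toReal_coe]
    exact M.abs_resolvent_le _ (fun s => by rw [← M.bellman_zero]; exact (hr s).le) s
  rw [tendsto_iff_norm_sub_tendsto_zero, ← tendsto_zero_iff_norm_tendsto_zero]
  have hlim : Tendsto (fun r => ∑ s', (1 - M.γ)⁻¹ * (M.occupancy (π t) s).real {s'} *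
      ((M.bellman (π r) 0 s' - M.bellman (π t) 0 s') +
      ∑ x, (M.V (π r) x).toReal * ((M.bellman (π r) (Pi.single x 1) s' - M.bellman (π r) 0 s') -
        (M.bellman (π t) (Pi.single x 1) s' - M.bellman (π t) 0 s')))) l (𝓝 0) := by
    have hz : ∀ W s', Tendsto (fun r => M.bellman (π r) W s' - M.bellman (π t) W s') l (𝓝 0) :=
      fun W s' => by simpa using (h W s').sub_const (M.bellman (π t) W s')
    rw [show (0 : ℝ) = ∑ s' : S, (1 - M.γ)⁻¹ * (M.occupancy (π t) s).real {s'} *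
      (0 + ∑ _x : S, 0) by simp]
    refine tendsto_finsetSum _ fun s' _ => ((hz 0 s').add
      (tendsto_finsetSum _ fun x _ => ?_)).const_mul _
    refine bdd_le_mul_tendsto_zero' ((C + 1) * (1 - M.γ)⁻¹) (hbdd.mono fun r hr => hr x) ?_
    have := (hz (Pi.single x 1) s').sub (hz 0 s')
    rw [sub_zero] at this
    exact this.congr fun r => by ring
  refine hlim.congr' ?_
  filter_upwards [hl] with r hr
  rw [M.V_sub_V (π t) (π r) ht hr, M.resolvent_eq_sum]
  exact Finset.sum_congr rfl fun s' _ => by rw [← M.bellman_sub_bellman]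

/-- If the Bellman operators `T_r` of the policies `π r` are differentiable at `t`, then so are the
value functions, with derivative `(1 - γ P_{π t})⁻¹ ((∂_r T_r) V)` where `V` is the value function
at time `t`. -/
theorem hasDerivAt_V {π : ℝ → Kernel S A} [∀ t, IsMarkovKernel (π t)] {t : ℝ}
    (hl : ∀ᶠ r in 𝓝 t, ∀ s, klDiv (π r s) M.μ ≠ ⊤) {b' : (S → ℝ) → S → ℝ}
    (h : ∀ W s, HasDerivAt (fun r => M.bellman (π r) W s) (b' W s) t) (s : S) :
    HasDerivAt (fun r => (M.V (π r) s).toReal)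
      (M.resolvent (π t) (b' fun x => (M.V (π t) x).toReal) s) t := by
  classical
  have ht := hl.self_of_nhds
  have hcont : ∀ x, ContinuousAt (fun r => (M.V (π r) x).toReal) t := fun x =>
    M.tendsto_V ht hl (fun W s => (h W s).continuousAt) x
  -- the derivative inherits from the Bellman operator that it is affine in `W`
  have hb' : ∀ W s', b' W s' = b' 0 s' + ∑ x, W x * (b' (Pi.single x 1) s' - b' 0 s') := by
    intro W s'
    have h1 : HasDerivAt (fun r => M.bellman (π r) W s')
        (b' 0 s' + ∑ x, W x * (b' (Pi.single x 1) s' - b' 0 s')) t := by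
      simp only [fun r => M.bellman_eq_sum (π r) W s']
      exact (h 0 s').add (HasDerivAt.fun_sum fun x _ =>
        ((h (Pi.single x 1) s').sub (h 0 s')).const_mul (W x))
    exact (h W s').unique h1
  rw [M.resolvent_eq_sum]
  have hlim : HasDerivAt (fun r => (M.V (π t) s).toReal + ∑ s', (1 - M.γ)⁻¹ *
      (M.occupancy (π t) s).real {s'} *
      ((M.bellman (π r) 0 s' - M.bellman (π t) 0 s') +
      ∑ x, (M.V (π r) x).toReal * ((M.bellman (π r) (Pi.single x 1) s' - M.bellman (π r) 0 s') -
        (M.bellman (π t) (Pi.single x 1) s' - M.bellman (π t) 0 s'))))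
      (∑ s', (1 - M.γ)⁻¹ * (M.occupancy (π t) s).real {s'} *
        b' (fun x => (M.V (π t) x).toReal) s') t := by
    refine HasDerivAt.const_add _ (HasDerivAt.fun_sum fun s' _ => HasDerivAt.const_mul _ ?_)
    rw [hb']
    exact ((h 0 s').sub_const _).add (HasDerivAt.fun_sum fun x _ =>
      HasDerivAt.continuousAt_mul_of_eq_zero
        (((h (Pi.single x 1) s').sub (h 0 s')).sub_const _) (sub_self _) (hcont x))
  refine hlim.congr_of_eventuallyEq ?_
  filter_upwards [hl] with r hr
  rw [← sub_eq_iff_eq_add', M.V_sub_V (π t) (π r) ht hr, M.resolvent_eq_sum]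
  exact Finset.sum_congr rfl fun s' _ => by rw [← M.bellman_sub_bellman]

end Variation

end EntropyMDP

/-! ### Measures with a density bounded above and below -/

section Densities

variable {A : Type*} [MeasurableSpace A]

theorem abs_log_le_of_mem {x B : ℝ} (h : Real.exp (-B) ≤ x ∧ x ≤ Real.exp B) :
    |Real.log x| ≤ B := by
  have hx : 0 < x := (Real.exp_pos _).trans_le h.1
  exact abs_le.2 ⟨(Real.le_log_iff_exp_le hx).2 h.1, (Real.log_le_iff_le_exp hx).2 h.2⟩

theorem densityMeasure_absolutelyContinuous (μ : Measure A) (h : A → ℝ) :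
    densityMeasure μ h ≪ μ :=
  withDensity_absolutelyContinuous _ _

theorem llr_densityMeasure {μ : Measure A} [SigmaFinite μ] {h : A → ℝ} (hm : Measurable h)
    (hh : ∀ᵐ a ∂μ, 0 ≤ h a) :
    llr (densityMeasure μ h) μ =ᵐ[μ] fun a => Real.log (h a) := by
  filter_upwards [Measure.rnDeriv_withDensity μ hm.ennreal_ofReal, hh] with a ha h0
  rw [llr, densityMeasure, ha, ENNReal.toReal_ofReal h0]

theorem klDiv_densityMeasure {μ : Measure A} [IsProbabilityMeasure μ] {h : A → ℝ}
    (hm : Measurable h) [IsProbabilityMeasure (densityMeasure μ h)] {B : ℝ}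
    (hB : ∀ᵐ a ∂μ, Real.exp (-B) ≤ h a ∧ h a ≤ Real.exp B) :
    klDiv (densityMeasure μ h) μ ≠ ⊤ ∧
      (klDiv (densityMeasure μ h) μ).toReal = ∫ a, Real.log (h a) ∂(densityMeasure μ h) := by
  have hac := densityMeasure_absolutelyContinuous μ h
  have hllr : llr (densityMeasure μ h) μ =ᵐ[densityMeasure μ h] fun a => Real.log (h a) :=
    hac.ae_le (llr_densityMeasure hm (hB.mono fun a ha =>
    (Real.exp_pos _).le.trans ha.1))
  have hint : Integrable (llr (densityMeasure μ h) μ) (densityMeasure μ h) :=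
    (Integrable.of_bound hm.log.aestronglyMeasurable B (by
      filter_upwards [hac.ae_le hB] with a ha using abs_log_le_of_mem ha)).congr hllr.symm
  exact ⟨klDiv_ne_top hac hint, by
    rw [toReal_klDiv_of_measure_eq hac (by simp), integral_congr_ae hllr]⟩

theorem integral_densityMeasure {μ : Measure A} {h : A → ℝ} (hm : Measurable h)
    (hh : ∀ᵐ a ∂μ, 0 ≤ h a) (g : A → ℝ) :
    ∫ a, g a ∂(densityMeasure μ h) = ∫ a, g a * h a ∂μ := by
  rw [densityMeasure, integral_withDensity_eq_integral_toReal_smul hm.ennreal_ofReal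
    (ae_of_all _ fun _ => ENNReal.ofReal_lt_top)]
  refine integral_congr_ae (hh.mono fun a ha => ?_)
  simp only [ENNReal.toReal_ofReal ha, smul_eq_mul, mul_comm]

theorem integrable_of_isProbabilityMeasure_densityMeasure {μ : Measure A} {h : A → ℝ}
    (hm : Measurable h) (hh : ∀ᵐ a ∂μ, 0 ≤ h a) [IsProbabilityMeasure (densityMeasure μ h)] :
    Integrable h μ := by
  refine ⟨hm.aestronglyMeasurable, ?_⟩
  rw [hasFiniteIntegral_iff_ofReal hh]
  have : densityMeasure μ h univ = 1 := measure_univ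
  rw [densityMeasure, withDensity_apply _ MeasurableSet.univ, Measure.restrict_univ] at this
  rw [this]
  exact ENNReal.one_lt_top

/-- A Boltzmann policy with potential bounded by `B` has a density with values in
`[e^{-2B}, e^{2B}]`. -/
theorem boltzmann_eq_densityMeasure {S : Type*} {μ : Measure A} [IsProbabilityMeasure μ]
    {f : S → A → ℝ} {s : S} (hm : Measurable (f s)) {B : ℝ} (hB : ∀ a, |f s a| ≤ B) :
    ∃ h : A → ℝ, Measurable h ∧ boltzmann μ f s = densityMeasure μ h ∧
      ∀ a, Real.exp (-(2 * B)) ≤ h a ∧ h a ≤ Real.exp (2 * B) := by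
  have hint : Integrable (fun a => Real.exp (f s a)) μ :=
    Integrable.of_bound hm.exp.aestronglyMeasurable (Real.exp B) (ae_of_all _ fun a => by
      rw [Real.norm_of_nonneg (Real.exp_pos _).le]
      exact Real.exp_le_exp.2 (abs_le.1 (hB a)).2)
  have hZ1 : ∫ a, Real.exp (f s a) ∂μ ≤ Real.exp B := by
    have := integral_mono hint (integrable_const (Real.exp B))
      fun a => Real.exp_le_exp.2 (abs_le.1 (hB a)).2
    simpa using this
  have hZ2 : Real.exp (-B) ≤ ∫ a, Real.exp (f s a) ∂μ := by
    have := integral_mono (integrable_const (Real.exp (-B))) hint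
      fun a => Real.exp_le_exp.2 (abs_le.1 (hB a)).1
    simpa using this
  have hZ : 0 < ∫ a, Real.exp (f s a) ∂μ := (Real.exp_pos _).trans_le hZ2
  refine ⟨_, hm.exp.div_const _, rfl, fun a => ⟨?_, ?_⟩⟩
  · rw [le_div_iff₀ hZ]
    calc Real.exp (-(2 * B)) * _ ≤ Real.exp (-(2 * B)) * Real.exp B := by gcongr
      _ = Real.exp (-B) := by rw [← Real.exp_add]; ring_nf
      _ ≤ _ := Real.exp_le_exp.2 (abs_le.1 (hB a)).1
  · rw [div_le_iff₀ hZ]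
    calc Real.exp (f s a) ≤ Real.exp B := Real.exp_le_exp.2 (abs_le.1 (hB a)).2
      _ = Real.exp (2 * B) * Real.exp (-B) := by rw [← Real.exp_add]; ring_nf
      _ ≤ _ := by gcongr

end Densities

/-! ### The densities along the flow -/

namespace IsWassersteinFlow

variable {S : Type*} [MeasurableSpace S] {d : ℕ}
  {M : EntropyMDP S (EuclideanSpace ℝ (Fin d))} {U : EuclideanSpace ℝ (Fin d) → ℝ}
  {π : ℝ → Kernel S (EuclideanSpace ℝ (Fin d))} [∀ t, IsMarkovKernel (π t)]
  {p : ℝ → S → EuclideanSpace ℝ (Fin d) → ℝ}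

/-- `p_t e^U` is a density of `π_t` with respect to `μ`. -/
theorem eq_densityMeasure (hflow : IsWassersteinFlow M U π p) (hU : Continuous U)
    (hμ : M.μ = densityMeasure volume fun a => Real.exp (-U a)) {t : ℝ} (ht : 0 ≤ t) (s : S) :
    π t s = densityMeasure M.μ fun a => p t s a * Real.exp (U a) := by
  have hp := hflow.measurable_density t ht s
  have hUm := hU.measurable
  rw [hflow.density t ht s, hμ]
  unfold densityMeasure
  rw [← withDensity_mul _ (by fun_prop) (by fun_prop)]
  congr 1
  funext a
  rw [Pi.mul_apply, ← ENNReal.ofReal_mul (Real.exp_pos _).le]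
  congr 1
  rw [mul_comm, mul_assoc, ← Real.exp_add, add_neg_cancel, Real.exp_zero, mul_one]

theorem volume_absolutelyContinuous (hU : Continuous U)
    (hμ : M.μ = densityMeasure volume fun a => Real.exp (-U a)) :
    (volume : Measure (EuclideanSpace ℝ (Fin d))) ≪ M.μ := by
  rw [hμ]
  have := hU.measurable
  exact withDensity_absolutelyContinuous' (by fun_prop)
    (ae_of_all _ fun a => (ENNReal.ofReal_pos.2 (Real.exp_pos _)).ne')

theorem absolutelyContinuous_volume
    (hμ : M.μ = densityMeasure volume fun a => Real.exp (-U a)) :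
    M.μ ≪ (volume : Measure (EuclideanSpace ℝ (Fin d))) :=
  hμ ▸ densityMeasure_absolutelyContinuous _ _

/-- The densities `dπ_t/dμ` are bounded above and below, locally uniformly in time. -/
theorem exists_density_bound (hflow : IsWassersteinFlow M U π p) (hU : Continuous U)
    (hμ : M.μ = densityMeasure volume fun a => Real.exp (-U a)) (T : ℝ) :
    ∃ B, ∀ t, 0 ≤ t → t ≤ T → ∀ s, ∀ᵐ a, Real.exp (-B) ≤ p t s a * Real.exp (U a) ∧
      p t s a * Real.exp (U a) ≤ Real.exp B := by
  obtain ⟨B, hB⟩ := hflow.policy_class T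
  refine ⟨2 * B, fun t ht htT s => ?_⟩
  obtain ⟨f, hfm, hfB, hf⟩ := hB t ht htT
  obtain ⟨h, hm, hh, hhB⟩ := boltzmann_eq_densityMeasure (μ := M.μ) (f := f) (s := s)
    (hfm.comp measurable_prodMk_left) (hfB s)
  have hp := hflow.measurable_density t ht s
  have hUm := hU.measurable
  have h1 : densityMeasure M.μ (fun a => p t s a * Real.exp (U a)) = densityMeasure M.μ h := by
    rw [← hh, ← hf, hflow.eq_densityMeasure hU hμ ht]
  have h2 := (withDensity_eq_iff_of_sigmaFinite (by fun_prop) (by fun_prop)).1 h1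
  filter_upwards [(volume_absolutelyContinuous hU hμ).ae_le h2] with a ha
  -- the density is only seen through `ENNReal.ofReal`, whose value is positive here
  have h3 : p t s a * Real.exp (U a) = h a := by
    have hpos : 0 < h a := (Real.exp_pos _).trans_le (hhB a).1
    have h4 : 0 < p t s a * Real.exp (U a) :=
      ENNReal.ofReal_pos.1 (by rw [ha]; exact ENNReal.ofReal_pos.2 hpos)
    exact (ENNReal.ofReal_eq_ofReal_iff h4.le hpos.le).1 ha
  rw [h3]
  exact hhB a

theorem density_nonneg (hflow : IsWassersteinFlow M U π p) (hU : Continuous U)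
    (hμ : M.μ = densityMeasure volume fun a => Real.exp (-U a)) {t : ℝ} (ht : 0 ≤ t) (s : S) :
    ∀ᵐ a, 0 ≤ p t s a := by
  obtain ⟨B, hB⟩ := hflow.exists_density_bound hU hμ t
  filter_upwards [hB t ht le_rfl s] with a ha
  exact (pos_of_mul_pos_left ((Real.exp_pos _).trans_le ha.1) (Real.exp_pos _).le).le

theorem integrable_density (hflow : IsWassersteinFlow M U π p) (hU : Continuous U)
    (hμ : M.μ = densityMeasure volume fun a => Real.exp (-U a)) {t : ℝ} (ht : 0 ≤ t) (s : S) :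
    Integrable (p t s) := by
  have : IsProbabilityMeasure (densityMeasure volume (p t s)) := by
    rw [← hflow.density t ht s]; infer_instance
  exact integrable_of_isProbabilityMeasure_densityMeasure (hflow.measurable_density t ht s)
    (hflow.density_nonneg hU hμ ht s)

theorem continuous_density (hflow : IsWassersteinFlow M U π p) {t : ℝ} (ht : 0 < t) (s : S) :
    Continuous (p t s) :=
  ((hflow.regular s).contDiff_space t ht).continuous

/-- For positive times, the bounds on the density hold everywhere, by continuity. -/
theorem exists_density_bound_of_pos (hflow : IsWassersteinFlow M U π p) (hU : Continuous U)
    (hμ : M.μ = densityMeasure volume fun a => Real.exp (-U a)) (T : ℝ) :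
    ∃ B, ∀ t, 0 < t → t ≤ T → ∀ s a, Real.exp (-B) ≤ p t s a * Real.exp (U a) ∧
      p t s a * Real.exp (U a) ≤ Real.exp B := by
  obtain ⟨B, hB⟩ := hflow.exists_density_bound hU hμ T
  refine ⟨B, fun t ht htT s => ?_⟩
  have hc : Continuous fun a => p t s a * Real.exp (U a) :=
    (hflow.continuous_density ht s).mul hU.rexp
  have hcl : IsClosed {a | Real.exp (-B) ≤ p t s a * Real.exp (U a) ∧
      p t s a * Real.exp (U a) ≤ Real.exp B} :=
    (isClosed_le continuous_const hc).inter (isClosed_le hc continuous_const)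
  have h0 := (hcl.isOpen_compl.measure_eq_zero_iff (volume : Measure _)).1
    (mem_ae_iff.1 (hB t ht.le htT s))
  exact eq_univ_iff_forall.1 (compl_empty_iff.1 h0)

theorem density_pos (hflow : IsWassersteinFlow M U π p) (hU : Continuous U)
    (hμ : M.μ = densityMeasure volume fun a => Real.exp (-U a)) {t : ℝ} (ht : 0 < t) (s : S)
    (a : EuclideanSpace ℝ (Fin d)) : 0 < p t s a := by
  obtain ⟨B, hB⟩ := hflow.exists_density_bound_of_pos hU hμ t
  exact pos_of_mul_pos_left ((Real.exp_pos _).trans_le (hB t ht le_rfl s a).1) (Real.exp_pos _).le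

theorem klDiv_ne_top (hflow : IsWassersteinFlow M U π p) (hU : Continuous U)
    (hμ : M.μ = densityMeasure volume fun a => Real.exp (-U a)) {t : ℝ} (ht : 0 ≤ t) (s : S) :
    klDiv (π t s) M.μ ≠ ⊤ ∧ (klDiv (π t s) M.μ).toReal =
      ∫ a, Real.log (p t s a * Real.exp (U a)) * p t s a := by
  obtain ⟨B, hB⟩ := hflow.exists_density_bound hU hμ t
  have hp := hflow.measurable_density t ht s
  have hUm := hU.measurable
  have hpr : IsProbabilityMeasure (densityMeasure M.μ fun a => p t s a * Real.exp (U a)) := by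
    rw [← hflow.eq_densityMeasure hU hμ ht]; infer_instance
  have := klDiv_densityMeasure (μ := M.μ) (h := fun a => p t s a * Real.exp (U a)) (by fun_prop)
    ((absolutelyContinuous_volume hμ).ae_le (hB t ht le_rfl s))
  rw [← hflow.eq_densityMeasure hU hμ ht] at this
  refine ⟨this.1, this.2.trans ?_⟩
  rw [hflow.density t ht s, integral_densityMeasure hp (hflow.density_nonneg hU hμ ht s)]

theorem integrable_mul_density (hflow : IsWassersteinFlow M U π p) (hU : Continuous U)
    (hμ : M.μ = densityMeasure volume fun a => Real.exp (-U a)) {t : ℝ} (ht : 0 ≤ t) (s : S)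
    {g : EuclideanSpace ℝ (Fin d) → ℝ} (hg : Measurable g) {C : ℝ} (hgC : ∀ a, |g a| ≤ C) :
    Integrable fun a => g a * p t s a :=
  (hflow.integrable_density hU hμ ht s).bdd_mul hg.aestronglyMeasurable (ae_of_all _ hgC)

theorem integrable_density_mul_log (hflow : IsWassersteinFlow M U π p) (hU : Continuous U)
    (hμ : M.μ = densityMeasure volume fun a => Real.exp (-U a)) {t : ℝ} (ht : 0 ≤ t) (s : S) :
    Integrable fun a => p t s a * Real.log (p t s a * Real.exp (U a)) := by
  obtain ⟨B, hB⟩ := hflow.exists_density_bound hU hμ t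
  have hp := hflow.measurable_density t ht s
  have hUm := hU.measurable
  refine (hflow.integrable_density hU hμ ht s).mul_bdd (c := B)
    (Measurable.aestronglyMeasurable (by fun_prop)) ?_
  filter_upwards [hB t ht le_rfl s] with a ha
  exact abs_log_le_of_mem ha

end IsWassersteinFlow

namespace EntropyMDP

theorem exists_abs_cost_add_le {S A : Type*} [MeasurableSpace S] [MeasurableSpace A] [Fintype S]
    (M : EntropyMDP S A) (W : S → ℝ) :
    ∃ C, ∀ s a, |M.c (s, a) + M.γ * ∫ s', W s' ∂(M.P (s, a))| ≤ C := by
  obtain ⟨K, hK⟩ := M.bounded_c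
  obtain ⟨C, -, hC⟩ := exists_forall_abs_le W
  refine ⟨K + |M.γ| * C, fun s a => (abs_add_le _ _).trans (add_le_add (hK _) ?_)⟩
  rw [abs_mul]
  exact mul_le_mul_of_nonneg_left (abs_integral_le_of_forall_abs_le _ hC) (abs_nonneg _)

theorem measurable_cost_add {S A : Type*} [MeasurableSpace S] [MeasurableSpace A] [Fintype S]
    [MeasurableSingletonClass S] (M : EntropyMDP S A) (W : S → ℝ) (s : S) :
    Measurable fun a => M.c (s, a) + M.γ * ∫ s', W s' ∂(M.P (s, a)) :=
  (M.measurable_c.comp measurable_prodMk_left).add ((M.measurable_integral_P W s).const_mul _)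

end EntropyMDP

namespace IsWassersteinFlow

/-- The Bellman operator of `π_t`, written with the Lebesgue densities. -/
theorem bellman_eq_integral {S : Type*} [MeasurableSpace S] {d : ℕ}
    {M : EntropyMDP S (EuclideanSpace ℝ (Fin d))} {U : EuclideanSpace ℝ (Fin d) → ℝ}
    {π : ℝ → Kernel S (EuclideanSpace ℝ (Fin d))} [∀ t, IsMarkovKernel (π t)]
    {p : ℝ → S → EuclideanSpace ℝ (Fin d) → ℝ} [Fintype S] [MeasurableSingletonClass S]
    (hflow : IsWassersteinFlow M U π p) (hU : Continuous U)
    (hμ : M.μ = densityMeasure volume fun a => Real.exp (-U a)) {t : ℝ} (ht : 0 ≤ t)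
    (W : S → ℝ) (s : S) :
    M.bellman (π t) W s = ∫ a, ((M.c (s, a) + M.γ * ∫ s', W s' ∂(M.P (s, a))) * p t s a +
      M.τ * (p t s a * Real.log (p t s a * Real.exp (U a)))) := by
  obtain ⟨C, hC⟩ := M.exists_abs_cost_add_le W
  rw [EntropyMDP.bellman, (hflow.klDiv_ne_top hU hμ ht s).2, hflow.density t ht s,
    integral_densityMeasure (hflow.measurable_density t ht s) (hflow.density_nonneg hU hμ ht s),
    ← integral_const_mul, ← integral_add (hflow.integrable_mul_density hU hμ ht s
      (M.measurable_cost_add W s) (hC s))]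
  · simp only [mul_comm (p t s _) (Real.log _)]
  · simp only [mul_comm (Real.log _) (p t s _)]
    exact (hflow.integrable_density_mul_log hU hμ ht s).const_mul _

end IsWassersteinFlow

/-! ### Divergences and gradients -/

section VectorCalculus

variable {d : ℕ}

theorem gradient_apply (f : EuclideanSpace ℝ (Fin d) → ℝ) (a : EuclideanSpace ℝ (Fin d))
    (i : Fin d) : ∇ f a i = fderiv ℝ f a (EuclideanSpace.single i 1) := by
  rw [← InnerProductSpace.toDual_symm_apply, EuclideanSpace.inner_single_right]
  simp [gradient]

theorem divergence_eq_sum {X : EuclideanSpace ℝ (Fin d) → EuclideanSpace ℝ (Fin d)}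
    {a : EuclideanSpace ℝ (Fin d)} (hX : DifferentiableAt ℝ X a) :
    divergence X a = ∑ i, fderiv ℝ (fun x => X x i) a (EuclideanSpace.single i 1) := by
  refine Finset.sum_congr rfl fun i _ => ?_
  have h := ((EuclideanSpace.proj i : EuclideanSpace ℝ (Fin d) →L[ℝ] ℝ).hasFDerivAt
    (x := X a)).comp a hX.hasFDerivAt
  exact (congrArg (fun L : EuclideanSpace ℝ (Fin d) →L[ℝ] ℝ => L (EuclideanSpace.single i 1))
    h.fderiv).symm

theorem differentiable_gradient {f : EuclideanSpace ℝ (Fin d) → ℝ} (hf : ContDiff ℝ 2 f) :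
    Differentiable ℝ (∇ f) := by
  rw [differentiable_euclidean]
  intro i
  simp only [gradient_apply]
  exact ((hf.fderiv_right (m := 1) (by norm_num)).differentiable (by norm_num)).clm_apply
    (differentiable_const _)

theorem divergence_gradient {f : EuclideanSpace ℝ (Fin d) → ℝ} (hf : ContDiff ℝ 2 f)
    (a : EuclideanSpace ℝ (Fin d)) : divergence (∇ f) a = Laplacian.laplacian f a := by
  rw [divergence_eq_sum (differentiable_gradient hf a),
    InnerProductSpace.laplacian_eq_iteratedFDeriv_orthonormalBasis f
      (EuclideanSpace.basisFun (Fin d) ℝ)]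
  refine Finset.sum_congr rfl fun i _ => ?_
  have hd : DifferentiableAt ℝ (fderiv ℝ f) a :=
    (hf.fderiv_right (m := 1) (by norm_num)).differentiable (by norm_num) a
  simp only [gradient_apply, iteratedFDeriv_two_apply, EuclideanSpace.basisFun_apply]
  rw [fderiv_clm_apply hd (differentiableAt_const _)]
  simp

theorem divergence_add {X Y : EuclideanSpace ℝ (Fin d) → EuclideanSpace ℝ (Fin d)}
    {a : EuclideanSpace ℝ (Fin d)} (hX : DifferentiableAt ℝ X a) (hY : DifferentiableAt ℝ Y a) :
    divergence (fun x => X x + Y x) a = divergence X a + divergence Y a := by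
  rw [divergence, divergence, divergence, ← Finset.sum_add_distrib, fderiv_fun_add hX hY]
  rfl

theorem divergence_const_smul {X : EuclideanSpace ℝ (Fin d) → EuclideanSpace ℝ (Fin d)}
    {a : EuclideanSpace ℝ (Fin d)} (hX : DifferentiableAt ℝ X a) (c : ℝ) :
    divergence (fun x => c • X x) a = c * divergence X a := by
  rw [divergence, divergence, Finset.mul_sum, fderiv_fun_const_smul hX]
  rfl

theorem gradient_eq_of_hasFDerivAt {f : EuclideanSpace ℝ (Fin d) → ℝ}
    {a v : EuclideanSpace ℝ (Fin d)} (h : HasFDerivAt f (innerSL ℝ v) a) : ∇ f a = v := by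
  rw [gradient, h.fderiv]
  exact (InnerProductSpace.toDual ℝ _).symm_apply_apply v

theorem hasFDerivAt_innerSL_gradient {f : EuclideanSpace ℝ (Fin d) → ℝ}
    {a : EuclideanSpace ℝ (Fin d)} (h : DifferentiableAt ℝ f a) :
    HasFDerivAt f (innerSL ℝ (∇ f a)) a := by
  have h1 : innerSL ℝ (∇ f a) = fderiv ℝ f a :=
    (InnerProductSpace.toDual ℝ _).apply_symm_apply (fderiv ℝ f a)
  rw [h1]
  exact h.hasFDerivAt

theorem integrable_exp_neg_mul_sq_norm {b : ℝ} (hb : 0 < b) :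
    Integrable fun a : EuclideanSpace ℝ (Fin d) => Real.exp (-b * ‖a‖ ^ 2) := by
  have := (GaussianFourier.integrable_cexp_neg_mul_sq_norm_add (b := (b : ℂ))
    (V := EuclideanSpace ℝ (Fin d)) (by simpa using hb) 0 0).norm
  refine this.congr (ae_of_all _ fun a => ?_)
  simp only [Complex.norm_exp]
  congr 1
  simp [← Complex.ofReal_pow]

end VectorCalculus

namespace IsWassersteinFlow

/-! ### Energy dissipation -/

section Dissipation

variable {S : Type*} [MeasurableSpace S] {d : ℕ}
  {M : EntropyMDP S (EuclideanSpace ℝ (Fin d))} {U : EuclideanSpace ℝ (Fin d) → ℝ}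
  {π : ℝ → Kernel S (EuclideanSpace ℝ (Fin d))} [∀ t, IsMarkovKernel (π t)]
  {p : ℝ → S → EuclideanSpace ℝ (Fin d) → ℝ}

theorem continuous_deriv_density (hflow : IsWassersteinFlow M U π p) {t : ℝ} (ht : 0 < t)
    (s : S) : Continuous fun a => deriv (fun r => p r s a) t := by
  have h : Continuous fun a : EuclideanSpace ℝ (Fin d) => (t, a) := by fun_prop
  exact (hflow.regular s).continuous_time.comp_continuous h fun a => ⟨ht, mem_univ a⟩

/-- The Gaussian bounds dominate `∂ₜ p` by an integrable function, locally uniformly in time. -/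
theorem exists_integrable_bound_deriv (hflow : IsWassersteinFlow M U π p) {t : ℝ} (ht : 0 < t)
    (s : S) : ∃ G : EuclideanSpace ℝ (Fin d) → ℝ, Integrable G ∧
      ∀ r ∈ Ioo (t / 2) (2 * t), ∀ a, |deriv (fun r => p r s a) r| ≤ G a := by
  obtain ⟨K, δ, hK, hδ, h⟩ := hflow.bounds s (t / 2) (2 * t) (by positivity) (by linarith)
  have hc : ContinuousOn (fun r : ℝ => r ^ ((2 - (d : ℝ)) / 2)) (Icc (t / 2) (2 * t)) :=
    fun r hr => (Real.continuousAt_rpow_const r _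
      (Or.inl (lt_of_lt_of_le (by positivity) hr.1).ne')).continuousWithinAt
  obtain ⟨C, hC⟩ := isCompact_Icc.exists_bound_of_continuousOn hc
  refine ⟨fun a => K * C * Real.exp (-(1 / (4 * t) * δ) * ‖a‖ ^ 2),
    (integrable_exp_neg_mul_sq_norm (by positivity)).const_mul _, fun r hr a => ?_⟩
  have hr0 : 0 < r := lt_trans (by positivity) hr.1
  have h1 := h r hr.1.le hr.2.le a
  have h2 : r ^ ((2 - (d : ℝ)) / 2) ≤ C := (le_abs_self _).trans (hC r ⟨hr.1.le, hr.2.le⟩)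
  have hC0 : 0 ≤ C := (norm_nonneg _).trans (hC r ⟨hr.1.le, hr.2.le⟩)
  have h3 : -(1 / (2 * r)) * δ * ‖a‖ ^ 2 ≤ -(1 / (4 * t) * δ) * ‖a‖ ^ 2 := by
    have h4 : 1 / (4 * t) ≤ 1 / (2 * r) :=
      one_div_le_one_div_of_le (by positivity) (by linarith [hr.2])
    have h5 := mul_le_mul_of_nonneg_right h4 (by positivity : 0 ≤ δ * ‖a‖ ^ 2)
    linarith
  calc |deriv (fun r => p r s a) r|
      ≤ |p r s a| + |deriv (fun r => p r s a) r| + ‖∇ (p r s) a‖ := by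
        linarith [abs_nonneg (p r s a), norm_nonneg (∇ (p r s) a)]
    _ ≤ _ := h1
    _ ≤ K * C * Real.exp (-(1 / (4 * t) * δ) * ‖a‖ ^ 2) := by gcongr

theorem integrable_deriv_density (hflow : IsWassersteinFlow M U π p) {t : ℝ} (ht : 0 < t)
    (s : S) : Integrable fun a => deriv (fun r => p r s a) t := by
  obtain ⟨G, hG, h⟩ := hflow.exists_integrable_bound_deriv ht s
  exact hG.mono' (hflow.continuous_deriv_density ht s).aestronglyMeasurable
    (ae_of_all _ fun a => h t ⟨by linarith, by linarith⟩ a)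

/-- Differentiation in time of linear functionals and of the entropy of the density. -/
theorem hasDerivAt_integral_density (hflow : IsWassersteinFlow M U π p) (hU : Continuous U)
    (hμ : M.μ = densityMeasure volume fun a => Real.exp (-U a)) {t : ℝ} (ht : 0 < t) (s : S)
    {g : EuclideanSpace ℝ (Fin d) → ℝ} (hg : Measurable g) {C : ℝ} (hgC : ∀ a, |g a| ≤ C)
    (σ : ℝ) :
    Integrable (fun a => (g a + σ * (Real.log (p t s a * Real.exp (U a)) + 1)) *
      deriv (fun r => p r s a) t) ∧
    HasDerivAt (fun r => ∫ a, (g a * p r s a +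
        σ * (p r s a * Real.log (p r s a * Real.exp (U a)))))
      (∫ a, (g a + σ * (Real.log (p t s a * Real.exp (U a)) + 1)) *
        deriv (fun r => p r s a) t) t := by
  obtain ⟨G, hG, hGb⟩ := hflow.exists_integrable_bound_deriv ht s
  obtain ⟨B, hB⟩ := hflow.exists_density_bound_of_pos hU hμ (2 * t)
  have hUm := hU.measurable
  have hI : Ioo (t / 2) (2 * t) ∈ 𝓝 t := Ioo_mem_nhds (by linarith) (by linarith)
  have hpos : ∀ r ∈ Ioo (t / 2) (2 * t), 0 < r := fun r hr => lt_trans (by positivity) hr.1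
  have hlog : ∀ r ∈ Ioo (t / 2) (2 * t), ∀ a, |Real.log (p r s a * Real.exp (U a))| ≤ B :=
    fun r hr a => abs_log_le_of_mem (hB r (hpos r hr) hr.2.le s a)
  have hmp : ∀ r ∈ Ioo (t / 2) (2 * t), Measurable (p r s) := fun r hr =>
    hflow.measurable_density r (hpos r hr).le s
  have htI : t ∈ Ioo (t / 2) (2 * t) := ⟨by linarith, by linarith⟩
  have hpt := hmp t htI
  have hdm := (hflow.continuous_deriv_density ht s).measurable
  refine hasDerivAt_integral_of_dominated_loc_of_deriv_le hI (bound := fun a =>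
    (C + |σ| * (B + 1)) * G a) ?_ ?_ (F' := fun r a =>
    (g a + σ * (Real.log (p r s a * Real.exp (U a)) + 1)) * deriv (fun r => p r s a) r) ?_ ?_
    (hG.const_mul _) ?_
  · filter_upwards [hI] with r hr
    have := hmp r hr
    exact Measurable.aestronglyMeasurable (by fun_prop)
  · exact (hflow.integrable_mul_density hU hμ ht.le s hg hgC).add
      ((hflow.integrable_density_mul_log hU hμ ht.le s).const_mul _)
  · exact Measurable.aestronglyMeasurable (by fun_prop)
  · refine ae_of_all _ fun a r hr => ?_
    have h1 := hlog r hr a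
    have h2 := hgC a
    have h3 := hGb r hr a
    have h4 : |g a + σ * (Real.log (p r s a * Real.exp (U a)) + 1)| ≤ C + |σ| * (B + 1) := by
      refine (abs_add_le _ _).trans (add_le_add h2 ?_)
      rw [abs_mul]
      refine mul_le_mul_of_nonneg_left ((abs_add_le _ _).trans ?_) (abs_nonneg _)
      rw [abs_one]
      linarith
    rw [norm_mul]
    exact mul_le_mul h4 h3 (abs_nonneg _) ((abs_nonneg _).trans h4)
  · refine ae_of_all _ fun a r hr => ?_
    have hd := ((hflow.regular s).differentiable_time r (hpos r hr) a).hasDerivAt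
    have hp := hflow.density_pos hU hμ (hpos r hr) s a
    have hl := (hd.mul_const (Real.exp (U a))).log (mul_pos hp (Real.exp_pos _)).ne'
    refine ((hd.const_mul (g a)).fun_add ((hd.fun_mul hl).const_mul σ)).congr_deriv ?_
    have := (Real.exp_pos (U a)).ne'
    have := hp.ne'
    field_simp

theorem integral_deriv_density_eq_zero (hflow : IsWassersteinFlow M U π p) (hU : Continuous U)
    (hμ : M.μ = densityMeasure volume fun a => Real.exp (-U a)) {t : ℝ} (ht : 0 < t) (s : S) :
    ∫ a, deriv (fun r => p r s a) t = 0 := by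
  have h := (hflow.hasDerivAt_integral_density hU hμ ht s (g := fun _ => 1) (C := 1)
    measurable_const (by simp) 0).2
  simp only [one_mul, zero_mul, add_zero] at h
  have h1 : (fun r => ∫ a, p r s a) =ᶠ[𝓝 t] fun _ => (1 : ℝ) := by
    filter_upwards [lt_mem_nhds ht] with r hr
    have h2 := integral_densityMeasure (hflow.measurable_density r hr.le s)
      (hflow.density_nonneg hU hμ hr.le s) (fun _ => 1)
    rw [← hflow.density r hr.le s] at h2
    simpa using h2.symm
  exact (h.congr_of_eventuallyEq h1.symm).unique (hasDerivAt_const t 1)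

theorem flowFlatDeriv_eq (hflow : IsWassersteinFlow M U π p) (hU : Continuous U)
    (hμ : M.μ = densityMeasure volume fun a => Real.exp (-U a)) {t : ℝ} (ht : 0 < t) (s : S) :
    flowFlatDeriv M U π p t s =
      fun a => M.Q (π t) s a + M.τ * (Real.log (p t s a) + U a) - (M.V (π t) s).toReal := by
  funext a
  rw [flowFlatDeriv, EntropyMDP.flatDeriv,
    Real.log_mul (hflow.density_pos hU hμ ht s a).ne' (Real.exp_pos _).ne', Real.log_exp]

theorem contDiff_flowFlatDeriv (hflow : IsWassersteinFlow M U π p) (hU : ContDiff ℝ 1 U)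
    (hμ : M.μ = densityMeasure volume fun a => Real.exp (-U a)) {t : ℝ} (ht : 0 < t) (s : S) :
    ContDiff ℝ 1 (flowFlatDeriv M U π p t s) := by
  rw [hflow.flowFlatDeriv_eq hU.continuous hμ ht]
  have hp : ContDiff ℝ 1 (p t s) := ((hflow.regular s).contDiff_space t ht).of_le (by norm_num)
  exact ((hflow.contDiff_Q t ht s).add (contDiff_const.mul ((hp.log fun a =>
    (hflow.density_pos hU.continuous hμ ht s a).ne').add hU))).sub contDiff_const

theorem smul_gradient_flowFlatDeriv (hflow : IsWassersteinFlow M U π p) (hU : ContDiff ℝ 1 U)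
    (hμ : M.μ = densityMeasure volume fun a => Real.exp (-U a)) {t : ℝ} (ht : 0 < t) (s : S)
    (a : EuclideanSpace ℝ (Fin d)) :
    p t s a • ∇ (flowFlatDeriv M U π p t s) a =
      (p t s a • ∇ (M.Q (π t) s) a + (M.τ * p t s a) • ∇ U a) + M.τ • ∇ (p t s) a := by
  have hpos := hflow.density_pos hU.continuous hμ ht s a
  have hQ := hasFDerivAt_innerSL_gradient
    ((hflow.contDiff_Q t ht s).differentiable (by norm_num) a)
  have hp := hasFDerivAt_innerSL_gradient
    (((hflow.regular s).contDiff_space t ht).differentiable (by norm_num) a)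
  have hU' := hasFDerivAt_innerSL_gradient (hU.differentiable (by norm_num) a)
  have hg : ∇ (flowFlatDeriv M U π p t s) a =
      ∇ (M.Q (π t) s) a + M.τ • ((p t s a)⁻¹ • ∇ (p t s) a + ∇ U a) := by
    refine gradient_eq_of_hasFDerivAt ?_
    rw [hflow.flowFlatDeriv_eq hU.continuous hμ ht]
    refine ((hQ.add (((hp.log hpos.ne').add hU').const_mul M.τ)).sub_const _).congr_fderiv ?_
    ext v
    simp
  have h1 : p t s a * (p t s a)⁻¹ = 1 := mul_inv_cancel₀ hpos.ne'
  rw [hg]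
  calc _ = p t s a • ∇ (M.Q (π t) s) a + (M.τ * p t s a) • ∇ U a +
        (M.τ * (p t s a * (p t s a)⁻¹)) • ∇ (p t s) a := by module
    _ = _ := by rw [h1, mul_one]

/-- The evolution equation says `∂ₜ p = ∇·(p ∇ (δV/δπ))`. -/
theorem divergence_smul_gradient_flowFlatDeriv (hflow : IsWassersteinFlow M U π p)
    (hU : ContDiff ℝ 1 U)
    (hμ : M.μ = densityMeasure volume fun a => Real.exp (-U a)) {t : ℝ} (ht : 0 < t) (s : S) :
    (Differentiable ℝ fun a => p t s a • ∇ (flowFlatDeriv M U π p t s) a) ∧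
      (divergence fun a => p t s a • ∇ (flowFlatDeriv M U π p t s) a) =
        fun a => deriv (fun r => p r s a) t := by
  have h2 := (hflow.regular s).contDiff_space t ht
  have hd := differentiable_gradient h2
  have hdr := hflow.differentiable_drift t ht s
  simp only [hflow.smul_gradient_flowFlatDeriv hU hμ ht s]
  refine ⟨hdr.add (hd.const_smul M.τ), funext fun a => ?_⟩
  rw [divergence_add (Y := fun a => M.τ • ∇ (p t s) a) (hdr a) ((hd a).const_smul M.τ),
    divergence_const_smul (hd a),
    divergence_gradient h2, hflow.equation t ht s a]

end Dissipation

end IsWassersteinFlow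

namespace IsWassersteinFlow

section Dissipation

variable {S : Type*} [MeasurableSpace S] {d : ℕ}
  {M : EntropyMDP S (EuclideanSpace ℝ (Fin d))} {U : EuclideanSpace ℝ (Fin d) → ℝ}
  {π : ℝ → Kernel S (EuclideanSpace ℝ (Fin d))} [∀ t, IsMarkovKernel (π t)]
  {p : ℝ → S → EuclideanSpace ℝ (Fin d) → ℝ}

theorem abs_mul_log_sub_mul_log_le {x y B : ℝ} (hx : Real.exp (-B) ≤ x ∧ x ≤ Real.exp B)
    (hy : Real.exp (-B) ≤ y ∧ y ≤ Real.exp B) :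
    |y * Real.log y - x * Real.log x| ≤ (B + 1) * |y - x| := by
  refine (convex_Icc (Real.exp (-B)) (Real.exp B)).norm_image_sub_le_of_norm_hasDerivWithin_le
    (f := fun x => x * Real.log x) (f' := fun x => Real.log x + 1) (fun z hz => ?_) (fun z hz => ?_)
    hx hy
  · exact (Real.hasDerivAt_mul_log ((Real.exp_pos _).trans_le hz.1).ne').hasDerivWithinAt
  · refine (norm_add_le _ _).trans ?_
    rw [norm_one]
    exact add_le_add_left (abs_log_le_of_mem hz) 1

theorem exists_abs_flowFlatDeriv_le [Fintype S] (hflow : IsWassersteinFlow M U π p) (hU : Continuous U)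
    (hμ : M.μ = densityMeasure volume fun a => Real.exp (-U a)) {t : ℝ} (ht : 0 < t) (s : S) :
    ∃ C, ∀ a, |flowFlatDeriv M U π p t s a| ≤ C := by
  obtain ⟨C, hC⟩ := M.exists_abs_cost_add_le fun x => (M.V (π t) x).toReal
  obtain ⟨B, hB⟩ := hflow.exists_density_bound_of_pos hU hμ t
  refine ⟨C + M.τ * B + |(M.V (π t) s).toReal|, fun a => ?_⟩
  refine (abs_sub _ _).trans (add_le_add_left ((abs_add_le _ _).trans
    (add_le_add (hC s a) ?_)) _)
  rw [abs_mul, abs_of_pos M.τ_pos]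
  exact mul_le_mul_of_nonneg_left (abs_log_le_of_mem (hB t ht le_rfl s a)) M.τ_pos.le

theorem dissipation_nonneg (hflow : IsWassersteinFlow M U π p) (hU : Continuous U)
    (hμ : M.μ = densityMeasure volume fun a => Real.exp (-U a)) {t : ℝ} (ht : 0 < t)
    (ρ : Measure S) : 0 ≤ dissipation M U π p ρ t :=
  mul_nonneg (inv_nonneg.2 (sub_nonneg.2 M.γ_lt_one.le)) (integral_nonneg fun s =>
    integral_nonneg fun a => mul_nonneg (sq_nonneg _) (hflow.density_pos hU hμ ht s a).le)

/-- The time derivative of the Bellman operator, at the value function, is minus the energy of the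
flat derivative. -/
theorem integrable_and_integral_eq_neg [Fintype S] (hflow : IsWassersteinFlow M U π p) (hU : ContDiff ℝ 1 U)
    (hμ : M.μ = densityMeasure volume fun a => Real.exp (-U a)) {t : ℝ} (ht : 0 < t) (s : S) :
    Integrable (fun a => ‖∇ (flowFlatDeriv M U π p t s) a‖ ^ 2 * p t s a) ∧
      ∫ a, ((M.c (s, a) + M.γ * ∫ s', (M.V (π t) s').toReal ∂(M.P (s, a))) +
        M.τ * (Real.log (p t s a * Real.exp (U a)) + 1)) * deriv (fun r => p r s a) t =
      -∫ a, ‖∇ (flowFlatDeriv M U π p t s) a‖ ^ 2 * p t s a := by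
  obtain ⟨C, hC⟩ := hflow.exists_abs_flowFlatDeriv_le hU.continuous hμ ht s
  obtain ⟨hX, hdiv⟩ := hflow.divergence_smul_gradient_flowFlatDeriv hU hμ ht s
  have hdi := hflow.integrable_deriv_density ht s
  have hF := hflow.contDiff_flowFlatDeriv hU hμ ht s
  obtain ⟨h1, h2⟩ := integrable_and_integral_mul_divergence_gradient hF hC
    (hflow.continuous_density ht s) (fun a => (hflow.density_pos hU.continuous hμ ht s a).le)
    (hflow.integrable_density hU.continuous hμ ht.le s) hX
    (by rw [hdiv]; exact hflow.continuous_deriv_density ht s) (by rw [hdiv]; exact hdi)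
  refine ⟨h1, ?_⟩
  rw [hdiv] at h2
  have h3 : ∀ a, ((M.c (s, a) + M.γ * ∫ s', (M.V (π t) s').toReal ∂(M.P (s, a))) +
      M.τ * (Real.log (p t s a * Real.exp (U a)) + 1)) * deriv (fun r => p r s a) t =
      flowFlatDeriv M U π p t s a * deriv (fun r => p r s a) t +
      (M.τ + (M.V (π t) s).toReal) * deriv (fun r => p r s a) t := fun a => by
    rw [flowFlatDeriv, EntropyMDP.flatDeriv, EntropyMDP.Q]
    ring
  simp only [h3]
  rw [integral_add (hdi.bdd_mul hF.continuous.aestronglyMeasurable (ae_of_all _ hC))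
    (hdi.const_mul _), integral_const_mul, hflow.integral_deriv_density_eq_zero hU.continuous hμ ht,
    mul_zero, add_zero, h2]

variable [Fintype S] [MeasurableSingletonClass S]

theorem hasDerivAt_bellman (hflow : IsWassersteinFlow M U π p) (hU : Continuous U)
    (hμ : M.μ = densityMeasure volume fun a => Real.exp (-U a)) {t : ℝ} (ht : 0 < t)
    (W : S → ℝ) (s : S) :
    HasDerivAt (fun r => M.bellman (π r) W s)
      (∫ a, ((M.c (s, a) + M.γ * ∫ s', W s' ∂(M.P (s, a))) +
        M.τ * (Real.log (p t s a * Real.exp (U a)) + 1)) * deriv (fun r => p r s a) t) t := by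
  obtain ⟨C, hC⟩ := M.exists_abs_cost_add_le W
  refine (hflow.hasDerivAt_integral_density hU hμ ht s (M.measurable_cost_add W s)
    (hC s) M.τ).2.congr_of_eventuallyEq ?_
  filter_upwards [lt_mem_nhds ht] with r hr
  exact hflow.bellman_eq_integral hU hμ hr.le W s

theorem integral_resolvent_energy (t : ℝ) (ρ : Measure S) [IsProbabilityMeasure ρ] :
    ∫ s, M.resolvent (π t) (fun s' => -∫ a, ‖∇ (flowFlatDeriv M U π p t s') a‖ ^ 2 * p t s' a) s ∂ρ
      = -dissipation M U π p ρ t := by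
  have h1 : 0 < 1 - M.γ := sub_pos.2 M.γ_lt_one
  rw [dissipation, M.integral_occupancyAvg, inv_mul_cancel_left₀ h1.ne', ← integral_neg]
  refine integral_congr_ae (ae_of_all _ fun s => ?_)
  simp only [M.resolvent_eq_sum, mul_neg, Finset.sum_neg_distrib]

theorem Vavg_eq_sum (κ : Kernel S (EuclideanSpace ℝ (Fin d))) [IsMarkovKernel κ] (ρ : Measure S)
    [IsProbabilityMeasure ρ] : M.Vavg κ ρ = ∑ s, ρ.real {s} * (M.V κ s).toReal :=
  integral_fintype .of_finite

/-- **Energy dissipation** at positive times. -/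
theorem hasDerivAt_Vavg (hflow : IsWassersteinFlow M U π p) (hU : ContDiff ℝ 1 U)
    (hμ : M.μ = densityMeasure volume fun a => Real.exp (-U a)) {t : ℝ} (ht : 0 < t)
    (ρ : Measure S) [IsProbabilityMeasure ρ] :
    HasDerivAt (fun r => M.Vavg (π r) ρ) (-dissipation M U π p ρ t) t := by
  have hfin : ∀ᶠ r in 𝓝 t, ∀ s, klDiv (π r s) M.μ ≠ ⊤ := by
    filter_upwards [lt_mem_nhds ht] with r hr s
    exact (hflow.klDiv_ne_top hU.continuous hμ hr.le s).1
  have hV := M.hasDerivAt_V hfin (hflow.hasDerivAt_bellman hU.continuous hμ ht)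
  simp only [(hflow.integrable_and_integral_eq_neg hU hμ ht _).2] at hV
  rw [← integral_resolvent_energy, integral_fintype .of_finite]
  simp only [Vavg_eq_sum]
  exact HasDerivAt.fun_sum fun s _ => (hV s).const_mul _

/-- Continuity of the Bellman operator at the initial time: the integrand is a Lipschitz function of
the density. -/
theorem tendsto_bellman_zero (hflow : IsWassersteinFlow M U π p) (hU : Continuous U)
    (hμ : M.μ = densityMeasure volume fun a => Real.exp (-U a)) (W : S → ℝ) (s : S) :
    Tendsto (fun r => M.bellman (π r) W s) (𝓝[>] 0) (𝓝 (M.bellman (π 0) W s)) := by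
  obtain ⟨C, hC⟩ := M.exists_abs_cost_add_le W
  obtain ⟨B, hB⟩ := hflow.exists_density_bound hU hμ 1
  have hint : ∀ r, 0 ≤ r → Integrable fun a =>
      (M.c (s, a) + M.γ * ∫ s', W s' ∂(M.P (s, a))) * p r s a +
        M.τ * (p r s a * Real.log (p r s a * Real.exp (U a))) := fun r hr =>
    (hflow.integrable_mul_density hU hμ hr s (M.measurable_cost_add W s) (hC s)).add
      ((hflow.integrable_density_mul_log hU hμ hr s).const_mul _)
  have hev : ∀ᶠ r : ℝ in 𝓝[>] 0, 0 < r ∧ r < 1 := Ioo_mem_nhdsGT one_pos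
  rw [hflow.bellman_eq_integral hU hμ le_rfl]
  have hlim := tendsto_integral_of_L1 (μ := volume) _ (hint 0 le_rfl).aestronglyMeasurable
    (F := fun r a => (M.c (s, a) + M.γ * ∫ s', W s' ∂(M.P (s, a))) * p r s a +
        M.τ * (p r s a * Real.log (p r s a * Real.exp (U a)))) (l := 𝓝[>] (0 : ℝ))
    (hev.mono fun r hr => hint r hr.1.le) ?_
  · refine hlim.congr' (hev.mono fun r hr => ?_)
    exact (hflow.bellman_eq_integral hU hμ hr.1.le W s).symm
  · have h0 : Tendsto (fun r => ENNReal.ofReal (C + M.τ * (B + 1)) *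
        ∫⁻ a, ‖p r s a - p 0 s a‖ₑ) (𝓝[>] 0) (𝓝 0) := by
      simpa using ENNReal.Tendsto.const_mul (hflow.initial s) (Or.inr ENNReal.ofReal_ne_top)
    refine tendsto_of_tendsto_of_tendsto_of_le_of_le' tendsto_const_nhds h0
      (Eventually.of_forall fun _ => zero_le) (hev.mono fun r hr => ?_)
    rw [← lintegral_const_mul' _ _ ENNReal.ofReal_ne_top]
    refine lintegral_mono_ae ?_
    filter_upwards [hB r hr.1.le hr.2.le s, hB 0 le_rfl zero_le_one s] with a ha ha0
    rw [← ofReal_norm, ← ofReal_norm, ← ENNReal.ofReal_mul' (norm_nonneg _)]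
    refine ENNReal.ofReal_le_ofReal ?_
    have h1 := abs_mul_log_sub_mul_log_le ha0 ha
    have hE := Real.exp_pos (U a)
    have h2 : |p r s a * Real.log (p r s a * Real.exp (U a)) -
        p 0 s a * Real.log (p 0 s a * Real.exp (U a))| ≤ (B + 1) * |p r s a - p 0 s a| := by
      rw [← sub_mul, abs_mul, abs_of_pos hE] at h1
      refine le_of_mul_le_mul_right ?_ hE
      calc _ = |p r s a * Real.exp (U a) * Real.log (p r s a * Real.exp (U a)) -
            p 0 s a * Real.exp (U a) * Real.log (p 0 s a * Real.exp (U a))| := by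
            rw [← abs_of_pos hE, ← abs_mul, abs_of_pos hE]
            congr 1
            ring
        _ ≤ _ := h1
        _ = _ := by ring
    have h3 : (M.c (s, a) + M.γ * ∫ s', W s' ∂(M.P (s, a))) * p r s a +
          M.τ * (p r s a * Real.log (p r s a * Real.exp (U a))) -
        ((M.c (s, a) + M.γ * ∫ s', W s' ∂(M.P (s, a))) * p 0 s a +
          M.τ * (p 0 s a * Real.log (p 0 s a * Real.exp (U a)))) =
        (M.c (s, a) + M.γ * ∫ s', W s' ∂(M.P (s, a))) * (p r s a - p 0 s a) +
        M.τ * (p r s a * Real.log (p r s a * Real.exp (U a)) -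
          p 0 s a * Real.log (p 0 s a * Real.exp (U a))) := by ring
    rw [h3, add_mul C, mul_assoc M.τ (B + 1)]
    refine (norm_add_le _ _).trans (add_le_add ?_ ?_)
    · rw [norm_mul]
      exact mul_le_mul_of_nonneg_right (hC s a) (norm_nonneg _)
    · rw [norm_mul, Real.norm_of_nonneg M.τ_pos.le]
      exact mul_le_mul_of_nonneg_left h2 M.τ_pos.le

theorem continuousOn_Vavg (hflow : IsWassersteinFlow M U π p) (hU : ContDiff ℝ 1 U)
    (hμ : M.μ = densityMeasure volume fun a => Real.exp (-U a))
    (ρ : Measure S) [IsProbabilityMeasure ρ] :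
    ContinuousOn (fun r => M.Vavg (π r) ρ) (Ici 0) := by
  intro t ht
  rcases (mem_Ici.1 ht).eq_or_lt with rfl | ht
  · refine continuousWithinAt_Ioi_iff_Ici.1 ?_
    have hfin : ∀ᶠ r in 𝓝[>] (0 : ℝ), ∀ s, klDiv (π r s) M.μ ≠ ⊤ := by
      filter_upwards [self_mem_nhdsWithin] with r hr s
      exact (hflow.klDiv_ne_top hU.continuous hμ (mem_Ioi.1 hr).le s).1
    simp only [ContinuousWithinAt, Vavg_eq_sum]
    exact tendsto_finsetSum _ fun s _ => (M.tendsto_V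
      (fun s => (hflow.klDiv_ne_top hU.continuous hμ le_rfl s).1) hfin
      (hflow.tendsto_bellman_zero hU.continuous hμ) s).const_mul _
  · exact (hflow.hasDerivAt_Vavg hU hμ ht ρ).continuousAt.continuousWithinAt

/-- **Energy dissipation** in integrated form, down to the initial time. The dissipation is
integrable since it is, up to the sign, the derivative of a monotone continuous function. -/
theorem intervalIntegrable_dissipation_and_Vavg_eq (hflow : IsWassersteinFlow M U π p)
    (hU : ContDiff ℝ 1 U) (hμ : M.μ = densityMeasure volume fun a => Real.exp (-U a)) {t : ℝ}
    (ht : 0 ≤ t) (ρ : Measure S) [IsProbabilityMeasure ρ] :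
    IntervalIntegrable (dissipation M U π p ρ) volume 0 t ∧
      M.Vavg (π t) ρ = M.Vavg (π 0) ρ - ∫ r in (0 : ℝ)..t, dissipation M U π p ρ r := by
  have hc : ContinuousOn (fun r => -M.Vavg (π r) ρ) (Icc 0 t) :=
    ((hflow.continuousOn_Vavg hU hμ ρ).mono Icc_subset_Ici_self).neg
  have hd : ∀ r ∈ Ioo 0 t, HasDerivAt (fun r => -M.Vavg (π r) ρ) (dissipation M U π p ρ r) r :=
    fun r hr => by simpa using (hflow.hasDerivAt_Vavg hU hμ hr.1 ρ).fun_neg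
  have hi : IntervalIntegrable (dissipation M U π p ρ) volume 0 t :=
    (intervalIntegrable_iff_integrableOn_Ioc_of_le ht).2
      (intervalIntegral.integrableOn_deriv_of_nonneg hc hd fun r hr =>
        hflow.dissipation_nonneg hU.continuous hμ hr.1 ρ)
  refine ⟨hi, ?_⟩
  rw [intervalIntegral.integral_eq_sub_of_hasDerivAt_of_le ht hc hd hi]
  ring

theorem hasDerivWithinAt_Vavg_zero (hflow : IsWassersteinFlow M U π p)
    (hU : ContDiff ℝ 1 U) (hμ : M.μ = densityMeasure volume fun a => Real.exp (-U a))
    (ρ : Measure S) [IsProbabilityMeasure ρ]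
    (hc : ContinuousWithinAt (dissipation M U π p ρ) (Ici 0) 0) :
    HasDerivWithinAt (fun r => M.Vavg (π r) ρ) (-dissipation M U π p ρ 0) (Ici 0) 0 := by
  have h1 := (hflow.intervalIntegrable_dissipation_and_Vavg_eq hU hμ zero_le_one ρ).1
  have hm : StronglyMeasurableAtFilter (dissipation M U π p ρ) (𝓝[>] 0) volume :=
    ⟨Ioc 0 1, Ioc_mem_nhdsGT one_pos, h1.1.aestronglyMeasurable⟩
  have h2 := intervalIntegral.integral_hasDerivWithinAt_right
    (IntervalIntegrable.refl (a := (0 : ℝ)) (f := dissipation M U π p ρ) (μ := volume))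
    (s := Ici 0) (t := Ioi 0) hm (hc.mono Ioi_subset_Ici_self)
  refine (h2.const_sub (M.Vavg (π 0) ρ)).congr (fun r hr => ?_) (by simp)
  exact (hflow.intervalIntegrable_dissipation_and_Vavg_eq hU hμ hr ρ).2

end Dissipation

end IsWassersteinFlow

/-! ### Uniform bounds -/

theorem supNorm_coe_le {X : Type*} {f : X → ℝ} {C : ℝ} (h : ∀ x, |f x| ≤ C) :
    supNorm (fun x => (f x : EReal)) ≤ ENNReal.ofReal C :=
  iSup_le fun x => by
    rw [EReal.abs_def]
    exact ENNReal.ofReal_le_ofReal (h x)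

theorem ofReal_abs_le_supNorm {X : Type*} (f : X → ℝ) (x : X) :
    ENNReal.ofReal |f x| ≤ supNorm fun x => (f x : EReal) :=
  le_iSup_of_le x (by rw [EReal.abs_def])

namespace EntropyMDP

variable {S A : Type*} [MeasurableSpace S] [MeasurableSpace A] (M : EntropyMDP S A)

theorem abs_Q_le (κ : Kernel S A) [IsMarkovKernel κ] {C : ℝ}
    (h : ∀ s, |(M.V κ s).toReal| ≤ C) (s : S) (a : A) :
    |M.Q κ s a| ≤ |M.c (s, a)| + M.γ * C := by
  refine (abs_add_le _ _).trans (add_le_add le_rfl ?_)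
  rw [abs_mul, abs_of_nonneg M.γ_nonneg]
  exact mul_le_mul_of_nonneg_left (abs_integral_le_of_forall_abs_le _ h) M.γ_nonneg

variable [Fintype S] [MeasurableSingletonClass S]

/-- The optimal value function is finite as soon as some stationary policy has finite entropy. -/
theorem coe_toReal_optValue (κ : Kernel S A) [IsMarkovKernel κ]
    (hκ : ∀ s, klDiv (κ s) M.μ ≠ ⊤) (s : S) :
    ((M.optValue s).toReal : EReal) = M.optValue s := by
  obtain ⟨B, hB⟩ := M.bounded_c
  refine EReal.coe_toReal (ne_of_lt ?_) (ne_of_gt ?_)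
  · refine lt_of_le_of_lt (iInf_le _ (stationaryPolicy κ)) ?_
    change M.V κ s < ⊤
    rw [← M.coe_toReal_V κ hκ]
    exact EReal.coe_lt_top _
  · exact lt_of_lt_of_le (EReal.bot_lt_coe _) (le_iInf fun π => M.neg_le_value hB π s)

theorem toReal_optValue_le (κ : Kernel S A) [IsMarkovKernel κ]
    (hκ : ∀ s, klDiv (κ s) M.μ ≠ ⊤) (s : S) :
    (M.optValue s).toReal ≤ (M.V κ s).toReal := by
  rw [← EReal.coe_le_coe_iff, M.coe_toReal_optValue κ hκ, M.coe_toReal_V κ hκ]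
  exact iInf_le _ (stationaryPolicy κ)

end EntropyMDP

namespace IsWassersteinFlow

variable {S : Type*} [MeasurableSpace S] {d : ℕ}
  {M : EntropyMDP S (EuclideanSpace ℝ (Fin d))} {U : EuclideanSpace ℝ (Fin d) → ℝ}
  {π : ℝ → Kernel S (EuclideanSpace ℝ (Fin d))} [∀ t, IsMarkovKernel (π t)]
  {p : ℝ → S → EuclideanSpace ℝ (Fin d) → ℝ} [Fintype S] [MeasurableSingletonClass S]

/-- The value functions decrease along the flow. -/
theorem toReal_V_le (hflow : IsWassersteinFlow M U π p)
    (hU : ContDiff ℝ 1 U) (hμ : M.μ = densityMeasure volume fun a => Real.exp (-U a)) {t : ℝ}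
    (ht : 0 ≤ t) (s : S) : (M.V (π t) s).toReal ≤ (M.V (π 0) s).toReal := by
  have h := (hflow.intervalIntegrable_dissipation_and_Vavg_eq hU hμ ht (Measure.dirac s)).2
  have h0 : 0 ≤ ∫ r in (0 : ℝ)..t, dissipation M U π p (Measure.dirac s) r :=
    intervalIntegral.integral_nonneg_of_ae_restrict ht (by
      rw [← restrict_Ioc_eq_restrict_Icc]
      filter_upwards [ae_restrict_mem measurableSet_Ioc] with r hr
      exact hflow.dissipation_nonneg hU.continuous hμ hr.1 _)
  simp only [EntropyMDP.Vavg, integral_dirac] at h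
  linarith

theorem max_supNorm_lt_top (hflow : IsWassersteinFlow M U π p) (hU : Continuous U)
    (hμ : M.μ = densityMeasure volume fun a => Real.exp (-U a)) :
    max (supNorm (M.V (π 0))) (supNorm M.optValue) < ⊤ := by
  have hfin := fun s => (hflow.klDiv_ne_top hU hμ le_rfl s).1
  refine max_lt ?_ ?_
  · obtain ⟨C, -, hC⟩ := exists_forall_abs_le fun s => (M.V (π 0) s).toReal
    rw [← funext (M.coe_toReal_V (π 0) hfin)]
    exact (supNorm_coe_le hC).trans_lt ENNReal.ofReal_lt_top
  · obtain ⟨C, -, hC⟩ := exists_forall_abs_le fun s => (M.optValue s).toReal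
    rw [← funext (M.coe_toReal_optValue (π 0) hfin)]
    exact (supNorm_coe_le hC).trans_lt ENNReal.ofReal_lt_top

theorem abs_toReal_V_le (hflow : IsWassersteinFlow M U π p)
    (hU : ContDiff ℝ 1 U) (hμ : M.μ = densityMeasure volume fun a => Real.exp (-U a)) {t : ℝ}
    (ht : 0 ≤ t) (s : S) :
    |(M.V (π t) s).toReal| ≤ (max (supNorm (M.V (π 0))) (supNorm M.optValue)).toReal := by
  have hfin := fun s => (hflow.klDiv_ne_top hU.continuous hμ le_rfl s).1
  have hfint := fun s => (hflow.klDiv_ne_top hU.continuous hμ ht s).1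
  refine (ENNReal.ofReal_le_iff_le_toReal (hflow.max_supNorm_lt_top hU.continuous hμ).ne).1 ?_
  have h0 := ofReal_abs_le_supNorm (fun s => (M.V (π 0) s).toReal) s
  have h1 := ofReal_abs_le_supNorm (fun s => (M.optValue s).toReal) s
  rw [funext (M.coe_toReal_V (π 0) hfin)] at h0
  rw [funext (M.coe_toReal_optValue (π 0) hfin)] at h1
  refine le_trans ?_ (max_le_max h0 h1)
  rw [← ENNReal.ofReal_max]
  exact ENNReal.ofReal_le_ofReal ((abs_le_max_abs_abs (M.toReal_optValue_le (π t) hfint s)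
    (hflow.toReal_V_le hU hμ ht s)).trans_eq (max_comm _ _))

theorem supNorm_V_le (hflow : IsWassersteinFlow M U π p)
    (hU : ContDiff ℝ 1 U) (hμ : M.μ = densityMeasure volume fun a => Real.exp (-U a)) {t : ℝ}
    (ht : 0 ≤ t) :
    supNorm (M.V (π t)) ≤ max (supNorm (M.V (π 0))) (supNorm M.optValue) := by
  rw [← funext (M.coe_toReal_V (π t) fun s => (hflow.klDiv_ne_top hU.continuous hμ ht s).1)]
  exact (supNorm_coe_le (hflow.abs_toReal_V_le hU hμ ht)).trans_eq
    (ENNReal.ofReal_toReal (hflow.max_supNorm_lt_top hU.continuous hμ).ne)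

theorem supNorm_Q_le (hflow : IsWassersteinFlow M U π p)
    (hU : ContDiff ℝ 1 U) (hμ : M.μ = densityMeasure volume fun a => Real.exp (-U a)) {t : ℝ}
    (ht : 0 ≤ t) :
    supNorm (fun x : S × EuclideanSpace ℝ (Fin d) => (M.Q (π t) x.1 x.2 : EReal)) ≤
      supNorm (fun x => (M.c x : EReal)) +
        ENNReal.ofReal M.γ * max (supNorm (M.V (π 0))) (supNorm M.optValue) := by
  refine iSup_le fun x => ?_
  rw [EReal.abs_def, ← ENNReal.ofReal_toReal (hflow.max_supNorm_lt_top hU.continuous hμ).ne,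
    ← ENNReal.ofReal_mul M.γ_nonneg]
  refine (ENNReal.ofReal_le_ofReal
    (M.abs_Q_le (π t) (hflow.abs_toReal_V_le hU hμ ht) x.1 x.2)).trans ?_
  refine ENNReal.ofReal_add_le.trans (add_le_add ?_ le_rfl)
  exact ofReal_abs_le_supNorm M.c x

/-- The `Q`-functions are bounded uniformly in time. -/
theorem exists_abs_Q_le (hflow : IsWassersteinFlow M U π p)
    (hU : ContDiff ℝ 1 U) (hμ : M.μ = densityMeasure volume fun a => Real.exp (-U a)) :
    ∃ K, ∀ t, 0 ≤ t → ∀ s a, |M.Q (π t) s a| ≤ K := by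
  obtain ⟨B, hB⟩ := M.bounded_c
  exact ⟨_, fun t ht s a => (M.abs_Q_le (π t) (hflow.abs_toReal_V_le hU hμ ht) s a).trans
    (add_le_add (hB _) le_rfl)⟩

end IsWassersteinFlow

/-! ### The Gibbs variational principle -/

section Gibbs

variable {A : Type*} [MeasurableSpace A]

/-- Change of the reference measure in the relative entropy. -/
theorem toReal_klDiv_tilted {μ m : Measure A} [IsProbabilityMeasure μ] [IsProbabilityMeasure m]
    {f : A → ℝ} (hf : Measurable f) {K : ℝ} (hK : ∀ a, |f a| ≤ K) (hm : klDiv m μ ≠ ⊤) :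
    klDiv m (μ.tilted f) ≠ ⊤ ∧ (klDiv m μ).toReal - ∫ a, f a ∂m =
      (klDiv m (μ.tilted f)).toReal - Real.log (∫ a, Real.exp (f a) ∂μ) := by
  obtain ⟨hac, hint⟩ := klDiv_ne_top_iff.1 hm
  have hfm : Integrable f m := Integrable.of_bound hf.aestronglyMeasurable K (ae_of_all _ hK)
  have hexp : Integrable (fun a => Real.exp (f a)) μ :=
    Integrable.of_bound hf.exp.aestronglyMeasurable (Real.exp K) (ae_of_all _ fun a => by
      rw [Real.norm_of_nonneg (Real.exp_pos _).le]
      exact Real.exp_le_exp.2 (abs_le.1 (hK a)).2)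
  have : IsProbabilityMeasure (μ.tilted f) := isProbabilityMeasure_tilted hexp
  have hac' : m ≪ μ.tilted f := hac.trans (absolutelyContinuous_tilted hexp)
  refine ⟨klDiv_ne_top hac' (integrable_llr_tilted_right hac hfm hint hexp), ?_⟩
  rw [toReal_klDiv_of_measure_eq hac (by simp), toReal_klDiv_of_measure_eq hac' (by simp),
    integral_llr_tilted_right hac hfm hexp hint]
  ring

end Gibbs

namespace EntropyMDP

variable {S A : Type*} [MeasurableSpace S] [MeasurableSpace A] (M : EntropyMDP S A)
  [Fintype S] [MeasurableSingletonClass S]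

/-- The Gibbs measure `e^{-Q/τ} μ / Z` is the unique minimiser in the proximal step: up to a constant
the objective is `τ KL(· | e^{-Q/τ} μ / Z)`. -/
theorem isProximal_iff (κ : Kernel S A) [IsMarkovKernel κ] {s : S} {K : ℝ}
    (hK : ∀ a, |M.Q κ s a| ≤ K) (m : Measure A) :
    M.IsProximal κ s m ↔ m = M.μ.tilted fun a => -(M.Q κ s a) / M.τ := by
  set f : A → ℝ := fun a => -(M.Q κ s a) / M.τ with hf
  have hτ := M.τ_pos
  have hfm : Measurable f := (M.measurable_Q κ s).neg.div_const _
  have hfK : ∀ a, |f a| ≤ K / M.τ := fun a => by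
    rw [hf, abs_div, abs_neg, abs_of_pos hτ]
    exact div_le_div_of_nonneg_right (hK a) hτ.le
  have hexp : Integrable (fun a => Real.exp (f a)) M.μ :=
    Integrable.of_bound hfm.exp.aestronglyMeasurable (Real.exp (K / M.τ)) (ae_of_all _ fun a => by
      rw [Real.norm_of_nonneg (Real.exp_pos _).le]
      exact Real.exp_le_exp.2 (abs_le.1 (hfK a)).2)
  have hprob : IsProbabilityMeasure (M.μ.tilted f) := isProbabilityMeasure_tilted hexp
  have htop : ∀ m : Measure A, klDiv m M.μ = ⊤ → M.proxObjective κ s m = ⊤ := fun m hm => by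
    rw [proxObjective, hm, ENNReal.mul_top (ENNReal.ofReal_pos.2 hτ).ne', EReal.coe_ennreal_top,
      EReal.coe_add_top]
  have hval : ∀ m : Measure A, IsProbabilityMeasure m → klDiv m M.μ ≠ ⊤ →
      M.proxObjective κ s m = ((M.τ * ((klDiv m (M.μ.tilted f)).toReal -
        Real.log (∫ a, Real.exp (f a) ∂M.μ)) : ℝ) : EReal) := fun m hmp hm => by
    have hQ : ∫ a, M.Q κ s a ∂m = -M.τ * ∫ a, f a ∂m := by
      rw [← integral_const_mul]
      refine integral_congr_ae (ae_of_all _ fun a => ?_)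
      simp only [hf]
      field_simp
    rw [← (toReal_klDiv_tilted hfm hfK hm).2, proxObjective, hQ,
      ← ENNReal.ofReal_toReal hm, ← ENNReal.ofReal_mul hτ.le, EReal.coe_ennreal_ofReal,
      max_eq_left (mul_nonneg hτ.le ENNReal.toReal_nonneg), ← EReal.coe_add,
      ENNReal.toReal_ofReal ENNReal.toReal_nonneg]
    congr 1
    ring
  -- the Gibbs measure has finite entropy since its density is bounded above and below
  have hfin : klDiv (M.μ.tilted f) M.μ ≠ ⊤ := by
    -- (a tilted measure is a Boltzmann policy with a single state)
    obtain ⟨h, hm, hh, hB⟩ := boltzmann_eq_densityMeasure (μ := M.μ) (f := fun _ : Unit => f)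
      (s := ()) hfm hfK
    have hh' : M.μ.tilted f = densityMeasure M.μ h := hh
    rw [hh'] at hprob ⊢
    exact (klDiv_densityMeasure hm (ae_of_all _ hB)).1
  have hmin := hval _ hprob hfin
  rw [klDiv_self, ENNReal.toReal_zero, zero_sub] at hmin
  constructor
  · rintro ⟨hmp, hm⟩
    have h1 := hm _ hprob
    have hmfin : klDiv m M.μ ≠ ⊤ := fun h => by
      rw [htop m h, hmin] at h1
      exact absurd h1 (not_le.2 (EReal.coe_lt_top _))
    rw [hval m hmp hmfin, hmin, EReal.coe_le_coe_iff] at h1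
    have h2 := le_of_mul_le_mul_left h1 hτ
    have h3 : (klDiv m (M.μ.tilted f)).toReal = 0 :=
      le_antisymm (by linarith) ENNReal.toReal_nonneg
    rw [ENNReal.toReal_eq_zero_iff] at h3
    exact klDiv_eq_zero_iff.1 (h3.resolve_right (toReal_klDiv_tilted hfm hfK hmfin).1)
  · rintro rfl
    refine ⟨hprob, fun m hmp => ?_⟩
    by_cases hm : klDiv m M.μ = ⊤
    · rw [htop m hm]
      exact le_top
    · rw [hval m hmp hm, hmin, EReal.coe_le_coe_iff]
      exact mul_le_mul_of_nonneg_left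
        (by linarith [ENNReal.toReal_nonneg (a := klDiv m (M.μ.tilted f))]) hτ.le

end EntropyMDP

/-! ### Perturbation of log-Sobolev inequalities -/

section HolleyStroock

theorem densityMeasure_le {A : Type*} [MeasurableSpace A] {μ : Measure A} {w : A → ℝ} {C : ℝ}
    (h : ∀ a, w a ≤ C) : densityMeasure μ w ≤ ENNReal.ofReal C • μ := by
  rw [← withDensity_const]
  exact withDensity_mono (ae_of_all _ fun a => ENNReal.ofReal_le_ofReal (h a))

theorem le_smul_densityMeasure {A : Type*} [MeasurableSpace A] {μ : Measure A} {w : A → ℝ}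
    (hw : Measurable w) {C : ℝ} (hC : 0 < C) (h : ∀ a, C⁻¹ ≤ w a) :
    μ ≤ ENNReal.ofReal C • densityMeasure μ w := by
  rw [densityMeasure, ← withDensity_smul _ hw.ennreal_ofReal]
  conv_lhs => rw [← withDensity_one (μ := μ)]
  refine withDensity_mono (ae_of_all _ fun a => ?_)
  rw [Pi.smul_apply, smul_eq_mul, ← ENNReal.ofReal_mul hC.le, Pi.one_apply, ← ENNReal.ofReal_one]
  refine ENNReal.ofReal_le_ofReal ?_
  rw [← mul_inv_cancel₀ hC.ne']
  exact mul_le_mul_of_nonneg_left (h a) hC.le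

theorem klDiv_densityMeasure_eq_lintegral {A : Type*} [MeasurableSpace A] {μ : Measure A}
    [IsProbabilityMeasure μ] {r : A → ℝ} (hr : Measurable r) (h0 : ∀ a, 0 ≤ r a)
    [IsProbabilityMeasure (densityMeasure μ r)] :
    klDiv (densityMeasure μ r) μ = ∫⁻ a, ENNReal.ofReal (klFun (r a)) ∂μ := by
  rw [klDiv_eq_lintegral_klFun_of_ac (densityMeasure_absolutelyContinuous μ r)]
  refine lintegral_congr_ae ?_
  filter_upwards [Measure.rnDeriv_withDensity μ hr.ennreal_ofReal] with a ha
  rw [densityMeasure, ha, ENNReal.toReal_ofReal (h0 a)]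

/-- The relative entropy of a probability density `r` is the least value over `c > 0` of
`∫ (r ln (r/c) - r + c)`. -/
theorem lintegral_klFun_le {A : Type*} [MeasurableSpace A] {μ : Measure A}
    [IsProbabilityMeasure μ] {r : A → ℝ} (hr : Measurable r) (h0 : ∀ a, 0 < r a)
    [IsProbabilityMeasure (densityMeasure μ r)] {c : ℝ} (hc : 0 < c) :
    ∫⁻ a, ENNReal.ofReal (klFun (r a)) ∂μ ≤
      ENNReal.ofReal c * ∫⁻ a, ENNReal.ofReal (klFun (r a / c)) ∂μ := by
  have hri : Integrable r μ :=
    integrable_of_isProbabilityMeasure_densityMeasure hr (ae_of_all _ fun a => (h0 a).le)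
  have hr1 : ∫ a, r a ∂μ = 1 := by
    have := integral_densityMeasure (μ := μ) hr (ae_of_all _ fun a => (h0 a).le) (fun _ => 1)
    simpa using this.symm
  have hmeas : Measurable fun a => klFun (r a / c) :=
    measurable_klFun.comp (hr.div_const c)
  have hkl0 : ∀ a, 0 ≤ klFun (r a / c) := fun a => klFun_nonneg (div_pos (h0 a) hc).le
  by_cases htop : ∫⁻ a, ENNReal.ofReal (klFun (r a / c)) ∂μ = ⊤
  · rw [htop, ENNReal.mul_top (ENNReal.ofReal_pos.2 hc).ne']
    exact le_top
  have hi : Integrable (fun a => klFun (r a / c)) μ :=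
    (lintegral_ofReal_ne_top_iff_integrable hmeas.aestronglyMeasurable
      (ae_of_all _ hkl0)).1 htop
  have heq : ∀ a, klFun (r a) = c * klFun (r a / c) + (Real.log c * r a + (1 - c)) := fun a => by
    rw [klFun_apply, klFun_apply, Real.log_div (h0 a).ne' hc.ne']
    field_simp
    ring
  have hj : Integrable (fun a => Real.log c * r a + (1 - c)) μ :=
    (hri.const_mul _).add (integrable_const _)
  have hi2 : Integrable (fun a => klFun (r a)) μ := by
    simp only [heq]
    exact (hi.const_mul c).add hj
  rw [← ofReal_integral_eq_lintegral_ofReal hi (ae_of_all _ hkl0),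
    ← ofReal_integral_eq_lintegral_ofReal hi2 (ae_of_all _ fun a => klFun_nonneg (h0 a).le),
    ← ENNReal.ofReal_mul hc.le]
  refine ENNReal.ofReal_le_ofReal ?_
  simp only [heq]
  rw [integral_add (hi.const_mul c) hj,
    integral_add (hri.const_mul _) (integrable_const _), integral_const_mul, integral_const_mul,
    hr1]
  simp only [integral_const, probReal_univ, one_smul, mul_one]
  linarith [Real.log_le_sub_one_of_pos hc]

theorem fisherInfo_densityMeasure {d : ℕ} {μ : Measure (EuclideanSpace ℝ (Fin d))}
    {r q : EuclideanSpace ℝ (Fin d) → ℝ} (hr : Measurable r) (hq : ContDiff ℝ 1 q)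
    (hq0 : ∀ a, 0 < q a) :
    fisherInfo (densityMeasure μ r) q =
      ∫⁻ a, ENNReal.ofReal (r a) * ENNReal.ofReal (‖∇ (fun x => Real.log (q x)) a‖ ^ 2) ∂μ := by
  have hm : Measurable fun a => ‖∇ (fun x => Real.log (q x)) a‖ ^ 2 :=
    ((continuous_gradient (hq.log fun a => (hq0 a).ne')).norm.pow 2).measurable
  rw [fisherInfo, densityMeasure, lintegral_withDensity_eq_lintegral_mul _ hr.ennreal_ofReal
    hm.ennreal_ofReal]
  rfl

/-- **Holley–Stroock perturbation**: the log-Sobolev inequality is stable under a change of measure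
whose density is bounded above and below. -/
theorem LogSobolev.tilted {d : ℕ} {μ : Measure (EuclideanSpace ℝ (Fin d))}
    [IsProbabilityMeasure μ] {α : ℝ} (hα : 0 < α) (h : LogSobolev μ α)
    {f : EuclideanSpace ℝ (Fin d) → ℝ} (hf : Measurable f) {K : ℝ} (hK : ∀ a, |f a| ≤ K) :
    LogSobolev (μ.tilted f) (α * Real.exp (-(4 * K))) := by
  intro r hr hr0 hprob
  -- a tilted measure is a Boltzmann policy with a single state
  obtain ⟨w, hw, hwμ, hwB⟩ := boltzmann_eq_densityMeasure (μ := μ) (f := fun _ : Unit => f)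
    (s := ()) hf hK
  have hwμ' : μ.tilted f = densityMeasure μ w := hwμ
  have hexp : Integrable (fun a => Real.exp (f a)) μ :=
    Integrable.of_bound hf.exp.aestronglyMeasurable (Real.exp K) (ae_of_all _ fun a => by
      rw [Real.norm_of_nonneg (Real.exp_pos _).le]
      exact Real.exp_le_exp.2 (abs_le.1 (hK a)).2)
  have hprob' : IsProbabilityMeasure (μ.tilted f) := isProbabilityMeasure_tilted hexp
  have hE := Real.exp_pos (2 * K)
  have hle1 : μ.tilted f ≤ ENNReal.ofReal (Real.exp (2 * K)) • μ :=
    hwμ' ▸ densityMeasure_le fun a => (hwB a).2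
  have hle2 : μ ≤ ENNReal.ofReal (Real.exp (2 * K)) • μ.tilted f :=
    hwμ' ▸ le_smul_densityMeasure hw hE fun a => by rw [← Real.exp_neg]; exact (hwB a).1
  have hrm : Measurable r := hr.continuous.measurable
  -- the mass `c` of `r μ`
  have hri : Integrable r (μ.tilted f) :=
    integrable_of_isProbabilityMeasure_densityMeasure hrm (ae_of_all _ fun a => (hr0 a).le)
  have hriμ : Integrable r μ :=
    (hri.smul_measure ENNReal.ofReal_ne_top).mono_measure hle2
  set c : ℝ := ∫ a, r a ∂μ with hc_def
  have hc : 0 < c := by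
    refine (integral_pos_iff_support_of_nonneg (fun a => (hr0 a).le) hriμ).2 ?_
    rw [Function.support_eq_univ (fun a => (hr0 a).ne'), measure_univ]
    exact one_pos
  have hq : ContDiff ℝ 1 fun a => r a / c := hr.div_const c
  have hq0 : ∀ a, 0 < r a / c := fun a => div_pos (hr0 a) hc
  have hqprob : IsProbabilityMeasure (densityMeasure μ fun a => r a / c) := by
    constructor
    rw [densityMeasure, withDensity_apply _ MeasurableSet.univ, Measure.restrict_univ,
      ← ofReal_integral_eq_lintegral_ofReal (hriμ.div_const c) (ae_of_all _ fun a => (hq0 a).le),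
      integral_div, ← hc_def, div_self hc.ne', ENNReal.ofReal_one]
  have hlsi := h _ hq hq0 hqprob
  rw [klDiv_densityMeasure_eq_lintegral hq.continuous.measurable (fun a => (hq0 a).le),
    fisherInfo_densityMeasure hq.continuous.measurable hq hq0] at hlsi
  rw [klDiv_densityMeasure_eq_lintegral hrm (fun a => (hr0 a).le),
    fisherInfo_densityMeasure hrm hr hr0]
  have hgrad : ∀ a, ∇ (fun x => Real.log (r x / c)) a = ∇ (fun x => Real.log (r x)) a := fun a => by
    have : (fun x => Real.log (r x / c)) = fun x => Real.log (r x) - Real.log c :=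
      funext fun x => Real.log_div (hr0 x).ne' hc.ne'
    rw [gradient, gradient, this, fderiv_sub_const]
  simp only [hgrad] at hlsi
  set g : EuclideanSpace ℝ (Fin d) → ℝ≥0∞ := fun a =>
    ENNReal.ofReal (‖∇ (fun x => Real.log (r x)) a‖ ^ 2) with hg
  have hscale : ∫⁻ a, ENNReal.ofReal (r a / c) * g a ∂μ =
      ENNReal.ofReal c⁻¹ * ∫⁻ a, ENNReal.ofReal (r a) * g a ∂μ := by
    rw [← lintegral_const_mul' _ _ ENNReal.ofReal_ne_top]
    refine lintegral_congr fun a => ?_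
    rw [div_eq_inv_mul, ENNReal.ofReal_mul (inv_pos.2 hc).le, mul_assoc]
  have hmono : ∀ {ν₁ ν₂ : Measure (EuclideanSpace ℝ (Fin d))} (k : EuclideanSpace ℝ (Fin d) → ℝ≥0∞),
      ν₁ ≤ ENNReal.ofReal (Real.exp (2 * K)) • ν₂ →
      ∫⁻ a, k a ∂ν₁ ≤ ENNReal.ofReal (Real.exp (2 * K)) * ∫⁻ a, k a ∂ν₂ := fun k hν =>
    (lintegral_mono' hν le_rfl).trans_eq (lintegral_smul_measure _ _)
  calc ∫⁻ a, ENNReal.ofReal (klFun (r a)) ∂(μ.tilted f)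
      ≤ ENNReal.ofReal c * ∫⁻ a, ENNReal.ofReal (klFun (r a / c)) ∂(μ.tilted f) :=
        lintegral_klFun_le hrm hr0 hc
    _ ≤ ENNReal.ofReal c * (ENNReal.ofReal (Real.exp (2 * K)) *
          ∫⁻ a, ENNReal.ofReal (klFun (r a / c)) ∂μ) := by gcongr; exact hmono _ hle1
    _ ≤ ENNReal.ofReal c * (ENNReal.ofReal (Real.exp (2 * K)) *
          (ENNReal.ofReal (1 / (2 * α)) * (ENNReal.ofReal c⁻¹ *
            (ENNReal.ofReal (Real.exp (2 * K)) *
              ∫⁻ a, ENNReal.ofReal (r a) * g a ∂(μ.tilted f))))) := by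
        gcongr
        refine hlsi.trans ?_
        rw [hscale]
        gcongr
        exact hmono _ hle2
    _ = _ := by
        simp only [← mul_assoc]
        congr 1
        rw [← ENNReal.ofReal_mul hc.le, ← ENNReal.ofReal_mul (by positivity),
          ← ENNReal.ofReal_mul (by positivity), ← ENNReal.ofReal_mul (by positivity)]
        congr 1
        rw [show 4 * K = 2 * K + 2 * K by ring, neg_add, Real.exp_add, Real.exp_neg]
        field_simp

end HolleyStroock

/-! ### The log-Sobolev inequality along the flow -/

namespace IsWassersteinFlow

variable {S : Type*} [MeasurableSpace S] {d : ℕ}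
  {M : EntropyMDP S (EuclideanSpace ℝ (Fin d))} {U : EuclideanSpace ℝ (Fin d) → ℝ}
  {π : ℝ → Kernel S (EuclideanSpace ℝ (Fin d))} [∀ t, IsMarkovKernel (π t)]
  {p : ℝ → S → EuclideanSpace ℝ (Fin d) → ℝ} [Fintype S] [MeasurableSingletonClass S]

/-- The density of `π_t` with respect to the proximal policy is `C¹` and positive. -/
theorem exists_density_tilted (hflow : IsWassersteinFlow M U π p)
    (hU : ContDiff ℝ 1 U) (hμ : M.μ = densityMeasure volume fun a => Real.exp (-U a)) {t : ℝ}
    (ht : 0 < t) (s : S) :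
    ∃ r : EuclideanSpace ℝ (Fin d) → ℝ, ContDiff ℝ 1 r ∧ (∀ a, 0 < r a) ∧
      π t s = densityMeasure (M.μ.tilted fun a => -(M.Q (π t) s a) / M.τ) r := by
  obtain ⟨K, hK⟩ := hflow.exists_abs_Q_le hU hμ
  have hp0 := hflow.density_pos hU.continuous hμ ht s
  have hp : ContDiff ℝ 1 (p t s) := ((hflow.regular s).contDiff_space t ht).of_le (by norm_num)
  have hQ := hflow.contDiff_Q t ht s
  set f : EuclideanSpace ℝ (Fin d) → ℝ := fun a => -(M.Q (π t) s a) / M.τ with hf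
  have hfc : ContDiff ℝ 1 f := hQ.neg.div_const _
  have hfm : Measurable f := hfc.continuous.measurable
  have hfK : ∀ a, f a ≤ K / M.τ := fun a =>
    div_le_div_of_nonneg_right ((neg_le_abs _).trans (hK t ht.le s a)) M.τ_pos.le
  have hexp : Integrable (fun a => Real.exp (f a)) M.μ :=
    Integrable.of_bound hfm.exp.aestronglyMeasurable (Real.exp (K / M.τ)) (ae_of_all _ fun a => by
      rw [Real.norm_of_nonneg (Real.exp_pos _).le]
      exact Real.exp_le_exp.2 (hfK a))
  have hZ : 0 < ∫ a, Real.exp (f a) ∂M.μ := integral_exp_pos hexp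
  set Z := ∫ a, Real.exp (f a) ∂M.μ with hZdef
  have hr : ContDiff ℝ 1 fun a => p t s a * Real.exp (U a) * (Z * Real.exp (-f a)) :=
    (hp.mul hU.exp).mul (contDiff_const.mul hfc.neg.exp)
  refine ⟨_, hr, fun a => ?_, ?_⟩
  · have := hp0 a
    positivity
  · rw [hflow.eq_densityMeasure hU.continuous hμ ht.le, Measure.tilted]
    unfold densityMeasure
    rw [← withDensity_mul _ (by fun_prop) hr.continuous.measurable.ennreal_ofReal]
    congr 1
    funext a
    rw [Pi.mul_apply, ← ENNReal.ofReal_mul (by positivity)]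
    congr 1
    rw [← hZdef, Real.exp_neg]
    have := (Real.exp_pos (f a)).ne'
    field_simp

/-- The proximal policies satisfy a log-Sobolev inequality uniformly in time, being perturbations of
`μ` by the uniformly bounded potentials `Q/τ`. -/
theorem exists_logSobolev_proximal (hflow : IsWassersteinFlow M U π p)
    (hU : ContDiff ℝ 1 U) (hμ : M.μ = densityMeasure volume fun a => Real.exp (-U a))
    {α₀ : ℝ} (hα₀ : 0 < α₀) (h : LogSobolev M.μ α₀) :
    ∃ α : ℝ, 0 < α ∧ ∀ t, 0 < t → ∀ s,
      (∃! m, M.IsProximal (π t) s m) ∧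
      ∀ m, M.IsProximal (π t) s m →
        ∃ r : EuclideanSpace ℝ (Fin d) → ℝ, ContDiff ℝ 1 r ∧ (∀ a, 0 < r a) ∧
          π t s = densityMeasure m r ∧
          klDiv (π t s) m ≤ ENNReal.ofReal (1 / (2 * α)) * fisherInfo (π t s) r := by
  obtain ⟨K, hK⟩ := hflow.exists_abs_Q_le hU hμ
  refine ⟨α₀ * Real.exp (-(4 * (K / M.τ))), by positivity, fun t ht s => ?_⟩
  have hiff := M.isProximal_iff (π t) (hK t ht.le s)
  refine ⟨⟨_, (hiff _).2 rfl, fun m hm => (hiff m).1 hm⟩, fun m hm => ?_⟩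
  obtain rfl := (hiff m).1 hm
  obtain ⟨r, hr, hr0, hπ⟩ := hflow.exists_density_tilted hU hμ ht s
  refine ⟨r, hr, hr0, hπ, ?_⟩
  have hprob : IsProbabilityMeasure (densityMeasure
      (M.μ.tilted fun a => -(M.Q (π t) s a) / M.τ) r) := by
    rw [← hπ]; infer_instance
  rw [hπ]
  refine LogSobolev.tilted hα₀ h ((M.measurable_Q (π t) s).neg.div_const _) (fun a => ?_)
    r hr hr0 hprob
  change |-(M.Q (π t) s a) / M.τ| ≤ _
  rw [abs_div, abs_neg, abs_of_pos M.τ_pos]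
  exact div_le_div_of_nonneg_right (hK t ht.le s a) M.τ_pos.le

end IsWassersteinFlow

theorem mainTheorem3 {S : Type*} [Fintype S] [MeasurableSpace S] [MeasurableSingletonClass S]
    {d : ℕ} (hd : 0 < d) (M : EntropyMDP S (EuclideanSpace ℝ (Fin d)))
    (U : EuclideanSpace ℝ (Fin d) → ℝ) (hU : ContDiff ℝ 1 U)
    (hμ : M.μ = densityMeasure volume fun a => Real.exp (-U a))
    (π : ℝ → Kernel S (EuclideanSpace ℝ (Fin d))) [∀ t, IsMarkovKernel (π t)]
    (p : ℝ → S → EuclideanSpace ℝ (Fin d) → ℝ) (hflow : IsWassersteinFlow M U π p) :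
    -- energy dissipation, for every initial distribution
    (∀ (ρ : Measure S) [IsProbabilityMeasure ρ],
      (∀ t, 0 < t →
        (∀ s, Integrable fun a => ‖∇ (flowFlatDeriv M U π p t s) a‖ ^ 2 * p t s a) ∧
        HasDerivAt (fun r => M.Vavg (π r) ρ) (-dissipation M U π p ρ t) t ∧
        -dissipation M U π p ρ t ≤ 0) ∧
      (∀ t, 0 ≤ t →
        IntervalIntegrable (dissipation M U π p ρ) volume 0 t ∧
        M.Vavg (π t) ρ = M.Vavg (π 0) ρ - ∫ r in (0 : ℝ)..t, dissipation M U π p ρ r) ∧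
      (ContinuousWithinAt (dissipation M U π p ρ) (Ici 0) 0 →
        HasDerivWithinAt (fun r => M.Vavg (π r) ρ) (-dissipation M U π p ρ 0) (Ici 0) 0)) ∧
    -- uniform bounds
    max (supNorm (M.V (π 0))) (supNorm M.optValue) < ⊤ ∧
    (∀ t, 0 ≤ t →
      supNorm (M.V (π t)) ≤ max (supNorm (M.V (π 0))) (supNorm M.optValue) ∧
      supNorm (fun x : S × EuclideanSpace ℝ (Fin d) => (M.Q (π t) x.1 x.2 : EReal)) ≤
        supNorm (fun x => (M.c x : EReal)) +
          ENNReal.ofReal M.γ * max (supNorm (M.V (π 0))) (supNorm M.optValue)) ∧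
    -- log-Sobolev inequality along the flow
    ((∃ α₀ : ℝ, 0 < α₀ ∧ LogSobolev M.μ α₀) →
      ∃ α : ℝ, 0 < α ∧ ∀ t, 0 < t → ∀ s,
        (∃! m, M.IsProximal (π t) s m) ∧
        ∀ m, M.IsProximal (π t) s m →
          ∃ r : EuclideanSpace ℝ (Fin d) → ℝ, ContDiff ℝ 1 r ∧ (∀ a, 0 < r a) ∧
            π t s = densityMeasure m r ∧
            klDiv (π t s) m ≤ ENNReal.ofReal (1 / (2 * α)) * fisherInfo (π t s) r) := by
  have hUc := hU.continuous
  refine ⟨fun ρ _ => ⟨fun t ht => ⟨fun s => (hflow.integrable_and_integral_eq_neg hU hμ ht s).1,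
      hflow.hasDerivAt_Vavg hU hμ ht ρ, neg_nonpos.2 (hflow.dissipation_nonneg hUc hμ ht ρ)⟩,
    fun t ht => hflow.intervalIntegrable_dissipation_and_Vavg_eq hU hμ ht ρ,
    hflow.hasDerivWithinAt_Vavg_zero hU hμ ρ⟩, hflow.max_supNorm_lt_top hUc hμ,
    fun t ht => ⟨hflow.supNorm_V_le hU hμ ht, hflow.supNorm_Q_le hU hμ ht⟩, ?_⟩
  rintro ⟨α₀, hα₀, h⟩
  exact hflow.exists_logSobolev_proximal hU hμ hα₀ h
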